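/- **Theorem.** Let $M$ be a transitive model of $\mathrm{ZFC}$ (a set or a proper class), let $j\colon M\to M$ be an elementary embedding (for the language of set theory $\{\in\}$) with critical point $\kappa$, and let $$\mathcal U=\{X\in\mathcal P(\kappa)\cap M : \kappa\in j(X)\}$$ be the ultrafilter on $\kappa$ derived from $j$ with seed $\kappa$. Suppose that $\mathcal U\in M$. Then: 1. $M\models o(\kappa)=(2^\kappa)^+$. 2. $M\models$ "for every $X\subseteq\mathcal P(\kappa)$ there is a normal measure $\mu$ on $\kappa$ such that $X\in\mathrm{Ult}(V,\mu)$". 3. For $\mathcal U$-measure one many $\alpha<\kappa$, statements 1 and 2 hold with $\alpha$ in place of $\kappa$; that is, $$\{\alpha<\kappa : M\models o(\alpha)=(2^\alpha)^+ \text{ and } M\models\text{"for every } X\subseteq\mathcal P(\alpha) \text{ there is a normal measure } \mu \text{ on } \alpha \text{ with } X\in\mathrm{Ult}(V,\mu)\text{"}\}\in\mathcal U .$$ 4. For every formula $\varphi(x)$ of the language of set theory in one free variable and every $A\in\mathcal P(\kappa)\cap M$, $$M\models\varphi(A)\iff\{\alpha<\kappa : M\models\varphi(A\cap\alpha)\}\in\mathcal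 U .$$ Here a normal measure on an uncountable ordinal $\kappa$ is a nonprincipal $\kappa$-complete ultrafilter on $\kappa$ that is closed under diagonal intersections; $\mathrm{Ult}(V,\mu)$ is the transitive collapse of the ultrapower of the universe by $\mu$; and $o(\kappa)$ is the height of the Mitchell order on the normal measures on $\kappa$, in which $\nu$ lies below $\mu$ iff $\nu\in\mathrm{Ult}(V,\mu)$. That is, $o(\mu)=\sup\{o(\nu)+1 : \nu \text{ below } \mu\}$ and $o(\kappa)=\sup\{o(\mu)+1 : \mu \text{ a normal measure on } \kappa\}$. -/

import Mathlib

universe u v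

namespace SetModel

/-! ## The language of set theory and its structures -/

/-- The only symbol of the language of set theory: the binary relation symbol for membership. -/
inductive SetRel : ℕ → Type
  | mem : SetRel 2

/-- The first-order language of set theory. -/
def setLang : FirstOrder.Language.{0, 0} where
  Functions := fun _ => Empty
  Relations := SetRel

/-- A class `M` of sets is a structure for the language of set theory, with the true membership
relation. `M` may be a set or a proper class. -/
instance structureOfClass (M : Set ZFSet.{u}) : setLang.Structure M where
  funMap := fun f => Empty.elim f
  RelMap := fun {n} r => match n, r with
    | _, SetRel.mem => fun x => (x 0 : ZFSet.{u}) ∈ (x 1 : ZFSet.{u})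

/-! ## Set-theoretic notions interpreted in a structure

Everything in this section is the usual definition in the language of set theory, interpreted in a
structure `A`: all quantifiers range over the elements of `A`, so that for instance
`IsNormalMeasure κ μ` says `A ⊨ "μ is a normal measure on κ"`. -/

section Interpretation

variable {A : Type v} [setLang.Structure A]

/-- The membership relation of the structure `A`. -/
def mem (x y : A) : Prop :=
  FirstOrder.Language.Structure.RelMap (L := setLang) SetRel.mem ![x, y]

infix:50 " ∊ " => mem

/-- `x ⊆ y` -/
def IsSubset (x y : A) : Prop := ∀ z, z ∊ x → z ∊ y

/-- `p = {x, y}` -/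
def IsUPair (p x y : A) : Prop := ∀ z, z ∊ p ↔ z = x ∨ z = y

/-- `p = (x, y)`, the Kuratowski pair `{{x}, {x, y}}` -/
def IsOPair (p x y : A) : Prop :=
  ∃ s t, IsUPair s x x ∧ IsUPair t x y ∧ IsUPair p s t

/-- `P` is the power set of `x`. -/
def IsPower (P x : A) : Prop := ∀ z, z ∊ P ↔ IsSubset z x

/-- `s = x ∪ {x}` -/
def IsSucc (s x : A) : Prop := ∀ z, z ∊ s ↔ z ∊ x ∨ z = x

/-- `x` is a transitive set. -/
def IsTrans (x : A) : Prop := ∀ y, y ∊ x → IsSubset y x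

/-- `x` is an ordinal: a transitive set of transitive sets. -/
def IsOrd (x : A) : Prop := IsTrans x ∧ ∀ y, y ∊ x → IsTrans y

/-- `(x, y) ∈ f` -/
def App (f x y : A) : Prop := ∃ p, IsOPair p x y ∧ p ∊ f

/-- `f` is a function with domain `a`. -/
def IsFunOn (f a : A) : Prop :=
  (∀ p, p ∊ f → ∃ x y, x ∊ a ∧ IsOPair p x y) ∧ ∀ x, x ∊ a → ∃! y, App f x y

/-- `f` is a function from `a` to `b`. -/
def IsFun (f a b : A) : Prop :=
  IsFunOn f a ∧ ∀ x y, App f x y → y ∊ b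

/-- `f` is a bijection from `a` onto `b`. -/
def IsBij (f a b : A) : Prop :=
  IsFun f a b ∧ ∀ y, y ∊ b → ∃! x, App f x y

/-- `θ = |x|`: the least ordinal in bijection with `x`. -/
def IsCardOf (θ x : A) : Prop :=
  IsOrd θ ∧ (∃ f, IsBij f θ x) ∧ ∀ η, η ∊ θ → ¬ ∃ f, IsBij f η x

/-- `θ` is a cardinal (an initial ordinal). -/
def IsCard (θ : A) : Prop := IsCardOf θ θ

/-- `η = θ⁺`: the least cardinal greater than `θ`. -/
def IsSuccCard (η θ : A) : Prop :=
  IsCard η ∧ θ ∊ η ∧ ∀ μ, IsCard μ → θ ∊ μ → IsSubset η μ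

/-- `η = (2^κ)⁺` -/
def IsSuccTwoPow (η κ : A) : Prop :=
  ∃ P θ, IsPower P κ ∧ IsCardOf θ P ∧ IsSuccCard η θ

/-! ### Normal measures -/

/-- `μ` is an ultrafilter on the set `κ`. -/
def IsUltrafilter (κ μ : A) : Prop :=
  (∀ X, X ∊ μ → IsSubset X κ) ∧
  κ ∊ μ ∧
  (∀ X Y, X ∊ μ → IsSubset X Y → IsSubset Y κ → Y ∊ μ) ∧
  (∀ X Y Z, X ∊ μ → Y ∊ μ → (∀ x, x ∊ Z ↔ x ∊ X ∧ x ∊ Y) → Z ∊ μ) ∧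
  (∀ X Y, IsSubset X κ → (∀ x, x ∊ Y ↔ x ∊ κ ∧ ¬ x ∊ X) → (X ∊ μ ↔ ¬ Y ∊ μ))

/-- `μ` is a normal measure on `κ`: `κ` is an ordinal above `ω`, and `μ` is a nonprincipal
`κ`-complete ultrafilter on `κ` that is closed under diagonal intersections. -/
def IsNormalMeasure (κ μ : A) : Prop :=
  IsOrd κ ∧
  -- some nonzero limit ordinal lies below `κ`
  (∃ w, w ∊ κ ∧ (∃ z, z ∊ w) ∧ ∀ z, z ∊ w → ∃ y, y ∊ w ∧ z ∊ y) ∧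
  IsUltrafilter κ μ ∧
  -- nonprincipal
  (∀ α s, α ∊ κ → IsUPair s α α → ¬ s ∊ μ) ∧
  -- closed under intersections of fewer than `κ` members
  (∀ γ f Y, γ ∊ κ → IsFun f γ μ →
    (∀ x, x ∊ Y ↔ x ∊ κ ∧ ∀ β X, App f β X → x ∊ X) → Y ∊ μ) ∧
  -- closed under diagonal intersections of `κ`-sequences
  (∀ f Y, IsFun f κ μ →
    (∀ x, x ∊ Y ↔ x ∊ κ ∧ ∀ β X, β ∊ x → App f β X → x ∊ X) → Y ∊ μ)

/-! ### Ultrapowers and the Mitchell order -/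

/-- `[g] = [h]` in the ultrapower by `μ`: `{α < κ : g(α) = h(α)} ∈ μ`. -/
def EqMod (κ μ g h : A) : Prop :=
  ∃ S, S ∊ μ ∧ ∀ α, α ∊ S ↔ α ∊ κ ∧ ∃ x, App g α x ∧ App h α x

/-- `[g] ∈ [h]` in the ultrapower by `μ`: `{α < κ : g(α) ∈ h(α)} ∈ μ`. -/
def MemMod (κ μ g h : A) : Prop :=
  ∃ S, S ∊ μ ∧ ∀ α, α ∊ S ↔ α ∊ κ ∧ ∃ x y, App g α x ∧ App h α y ∧ x ∊ y

/-- `T` is a set of functions on `κ` which, up to equality modulo `μ`, contains every member (in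
the sense of the ultrapower) of each of its elements, and `c` is the restriction to `T` of the
transitive collapse `g ↦ π([g])` of the ultrapower by `μ`, that is,
`c(g) = {c(h) : h ∈ T, [h] ∈ [g]}` for `g ∈ T`. -/
def IsCollapse (κ μ T c : A) : Prop :=
  (∀ g, g ∊ T → IsFunOn g κ) ∧
  (∀ g h, g ∊ T → IsFunOn h κ → MemMod κ μ h g → ∃ h', h' ∊ T ∧ EqMod κ μ h' h) ∧
  IsFunOn c T ∧
  ∀ g y, App c g y → ∀ z, z ∊ y ↔ ∃ h, h ∊ T ∧ MemMod κ μ h g ∧ App c h z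

/-- `X ∈ Ult(V, μ)`, where `μ` is a normal measure on `κ` and `Ult(V, μ)` is the transitive collapse
of the ultrapower of the universe by `μ`: `X = π([f])` for some function `f` on `κ`. The collapse
of `f` is computed along a set of functions that suffices for it. -/
def InUlt (κ μ X : A) : Prop :=
  ∃ T c f, IsCollapse κ μ T c ∧ App c f X

/-- `o(κ) = lam`, the height of the Mitchell order on the normal measures on `κ`
(`ν` is below `μ` iff `ν ∈ Ult(V, μ)`). Here `D` is the set of all normal measures on `κ`, `r` is
the rank function of the order, `r(μ) = sup {r(ν) + 1 : ν below μ}`, and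
`lam = sup {r(μ) + 1 : μ ∈ D}`. -/
def IsMitchellHeight (κ lam : A) : Prop :=
  ∃ D r, (∀ μ, μ ∊ D ↔ IsNormalMeasure κ μ) ∧ IsFunOn r D ∧
    (∀ μ ρ, App r μ ρ → ∀ ξ, ξ ∊ ρ ↔
      ∃ ν σ, ν ∊ D ∧ InUlt κ μ ν ∧ App r ν σ ∧ (ξ ∊ σ ∨ ξ = σ)) ∧
    (∀ ξ, ξ ∊ lam ↔ ∃ μ ρ, App r μ ρ ∧ (ξ ∊ ρ ∨ ξ = ρ))

/-- The assertion `o(κ) = (2^κ)⁺`, interpreted in `A`. -/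
def MitchellMaximal (κ : A) : Prop :=
  ∃ lam, IsMitchellHeight κ lam ∧ IsSuccTwoPow lam κ

/-- The assertion "for every `X ⊆ 𝒫(κ)` there is a normal measure `μ` on `κ` such that
`X ∈ Ult(V, μ)`", interpreted in `A`. -/
def UltsCaptureAll (κ : A) : Prop :=
  ∀ X, (∀ Y, Y ∊ X → IsSubset Y κ) → ∃ μ, IsNormalMeasure κ μ ∧ InUlt κ μ X

end Interpretation

/-! ## Models of ZFC -/

/-- `A ⊨ ZFC`. The two schemas range over all first-order formulas, with parameters `p`. -/
structure ModelsZFC (A : Type v) [setLang.Structure A] : Prop where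
  extensionality : ∀ x y : A, (∀ z, z ∊ x ↔ z ∊ y) → x = y
  foundation : ∀ x : A, (∃ y, y ∊ x) → ∃ y, y ∊ x ∧ ∀ z, z ∊ y → ¬ z ∊ x
  pairing : ∀ x y : A, ∃ p, IsUPair p x y
  union : ∀ x : A, ∃ y, ∀ z, z ∊ y ↔ ∃ w, w ∊ x ∧ z ∊ w
  powerset : ∀ x : A, ∃ P, IsPower P x
  infinity : ∃ w : A, (∃ e, e ∊ w ∧ ∀ z, ¬ z ∊ e) ∧ ∀ x, x ∊ w → ∃ s, s ∊ w ∧ IsSucc s x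
  separation : ∀ (n : ℕ) (φ : setLang.Formula (Fin (n + 1))) (p : Fin n → A) (a : A),
    ∃ b, ∀ x, x ∊ b ↔ x ∊ a ∧ φ.Realize (Fin.cons x p : Fin (n + 1) → A)
  replacement : ∀ (n : ℕ) (φ : setLang.Formula (Fin (n + 2))) (p : Fin n → A) (a : A),
    (∀ x y y', x ∊ a → φ.Realize (Fin.cons x (Fin.cons y p) : Fin (n + 2) → A) →
      φ.Realize (Fin.cons x (Fin.cons y' p) : Fin (n + 2) → A) → y = y') →
    ∃ b, ∀ y, y ∊ b ↔
      ∃ x, x ∊ a ∧ φ.Realize (Fin.cons x (Fin.cons y p) : Fin (n + 2) → A)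
  choice : ∀ F : A, (∀ x, x ∊ F → ∃ y, y ∊ x) →
    (∀ x y z, x ∊ F → y ∊ F → z ∊ x → z ∊ y → x = y) →
    ∃ C, ∀ x, x ∊ F → ∃! y, y ∊ x ∧ y ∊ C

/-- `M` is a transitive model of ZFC (a set or a proper class). -/
def IsTransitiveModelZFC (M : Set ZFSet.{u}) : Prop :=
  (∀ x ∈ M, ∀ y ∈ x, y ∈ M) ∧ ModelsZFC M

/-! ## Elementary embeddings, critical points, derived ultrafilters -/

/-- `κ` is the critical point of `j`: the least ordinal of `M` that is moved by `j`. -/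
def IsCrit {M : Set ZFSet.{u}} (j : setLang.ElementaryEmbedding M M) (κ : M) : Prop :=
  (κ : ZFSet.{u}).IsOrdinal ∧ j κ ≠ κ ∧ ∀ α : M, (α : ZFSet.{u}) ∈ (κ : ZFSet.{u}) → j α = α

/-- The ultrafilter on `κ` derived from `j` with seed `κ`:
`{X ∈ 𝒫(κ) ∩ M : κ ∈ j(X)}`. -/
def derivedUltrafilter {M : Set ZFSet.{u}} (j : setLang.ElementaryEmbedding M M) (κ : M) :
    Set ZFSet.{u} :=
  {X | ∃ hX : X ∈ M, X ⊆ (κ : ZFSet.{u}) ∧ (κ : ZFSet.{u}) ∈ (j ⟨X, hX⟩ : ZFSet.{u})}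

/-- `{α ∈ κ : P(α)} ∈ U`, for `κ` and `U` in `M` and a property `P` of elements of `M`. -/
def ForMeasureOneMany {M : Set ZFSet.{u}} (U κ : M) (P : M → Prop) : Prop :=
  ZFSet.sep (fun α => ∃ hα : α ∈ M, P ⟨α, hα⟩) (κ : ZFSet.{u}) ∈ (U : ZFSet.{u})

end SetModel

namespace SetModel

open FirstOrder Language

/-! ## Definable relations on a class -/

section Definability

variable {M : Set ZFSet.{u}}

/-! The core is a reflection argument for `UltsCaptureFamilies κ`: given sets F_A ⊆ P(κ) indexed by
A ⊆ κ, a single normal measure on κ has every F_A in its ultrapower. If this failed at κ in M,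
choose in M a counterexample f(α) for each α < κ where it fails. Since κ < j(κ) and j maps M into M
itself, j(f)(κ) is a counterexample for κ. But U is a normal measure of M, and it captures j(f)(κ):
as j(A) ∩ κ = A, the section at A is represented by α ↦ {Y ⊆ α : (A ∩ α, Y) ∈ f(α)}. This is
`IsCrit.ultsCaptureFamilies`.

A constant family yields claim 2. For claim 1, a measure below μ is represented by a function that
can be coded by a subset of κ, so P(κ) maps onto each ordinal below o(κ). It does not map onto o(κ):
otherwise choose for each A ⊆ κ a measure N_A of the rank assigned to A; a measure capturing all N_A
at once would have rank above every assigned rank, its own included. With `isSuccTwoPow_of_onto`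
this gives o(κ) = (2^κ)⁺. Claims 3 and 4 are instances of the Łoś-type equivalence
`IsCrit.large_iff`, the fourth again with j(A) ∩ κ = A.

Full ultrapowers are never formed. For X ⊆ P(κ), membership in the ultrapower is reduced by
`IsNormalMeasure.inUlt_iff` to `Rep`: some g satisfies Y ∈ X iff Y ∩ α ∈ g(α) for almost all α.
Well-foundedness of the Mitchell order (`wfOn_rep`) is then proved combinatorially, by a recursion
in the style of Yablo's paradox.

Separation, replacement and elementarity speak about formulas. The classes `Def` and `DefT` let
instance search produce these formulas: parameters from `Set.univ` serve the two schemas, parameters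
from `∅` serve elementarity. -/

/-- The relation `P` on the entries of `v` is definable over `M` with parameters from `C`. -/
class Def (C : Set M) (P : (ℕ → M) → Prop) : Prop where
  out : ∃ φ : setLang.Formula (ℕ ⊕ C), ∀ v, φ.Realize (Sum.elim v (fun c : C => (c : M))) ↔ P v

/-- The function `t` of the entries of `v` is definable over `M` with parameters from `C`. -/
class DefT (C : Set M) (t : (ℕ → M) → M) : Prop where
  out : Def C (fun v => v 0 = t (fun n => v (n + 1)))

/-- Prepend an entry to a sequence. -/
def scons (x : M) (v : ℕ → M) : ℕ → M
  | 0 => x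
  | n + 1 => v n

variable {C : Set M}

theorem Def.congr {P Q : (ℕ → M) → Prop} (h : Def C P) (hPQ : ∀ v, P v ↔ Q v) : Def C Q := by
  rwa [show Q = P from funext fun v => propext (hPQ v).symm]

theorem Def.relabel {P : (ℕ → M) → Prop} (h : Def C P) (f : ℕ → ℕ) :
    Def C (fun v => P (fun n => v (f n))) := by
  obtain ⟨φ, hφ⟩ := h.out
  refine ⟨φ.relabel (Sum.map f id), fun v => ?_⟩
  rw [Formula.realize_relabel, ← hφ]
  congr! 1
  funext x
  rcases x with n | c <;> rfl

instance Def.const (p : Prop) : Def C (fun _ => p) := by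
  by_cases hp : p
  · exact ⟨⊤, fun v => by simp [hp]⟩
  · exact ⟨⊥, fun v => by simp [hp]⟩

instance Def.and {P Q : (ℕ → M) → Prop} [h : Def C P] [h' : Def C Q] :
    Def C (fun v => P v ∧ Q v) := by
  obtain ⟨φ, hφ⟩ := h.out
  obtain ⟨ψ, hψ⟩ := h'.out
  exact ⟨φ ⊓ ψ, fun v => by rw [Formula.realize_inf, hφ, hψ]⟩

instance Def.or {P Q : (ℕ → M) → Prop} [h : Def C P] [h' : Def C Q] :
    Def C (fun v => P v ∨ Q v) := by
  obtain ⟨φ, hφ⟩ := h.out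
  obtain ⟨ψ, hψ⟩ := h'.out
  exact ⟨φ ⊔ ψ, fun v => by rw [Formula.realize_sup, hφ, hψ]⟩

instance Def.imp {P Q : (ℕ → M) → Prop} [h : Def C P] [h' : Def C Q] :
    Def C (fun v => P v → Q v) := by
  obtain ⟨φ, hφ⟩ := h.out
  obtain ⟨ψ, hψ⟩ := h'.out
  exact ⟨φ.imp ψ, fun v => by rw [Formula.realize_imp, hφ, hψ]⟩

instance Def.iff {P Q : (ℕ → M) → Prop} [h : Def C P] [h' : Def C Q] :
    Def C (fun v => P v ↔ Q v) := by
  obtain ⟨φ, hφ⟩ := h.out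
  obtain ⟨ψ, hψ⟩ := h'.out
  exact ⟨φ.iff ψ, fun v => by rw [Formula.realize_iff, hφ, hψ]⟩

/-- The quantified variable takes index 0 and the older variables move up by one, so nested
quantifiers can be left to instance search. -/
instance Def.exists {P : (ℕ → M) → M → Prop} [h : Def C (fun v => P (fun n => v (n + 1)) (v 0))] :
    Def C (fun v => ∃ x, P v x) := by
  obtain ⟨φ, hφ⟩ := h.out
  refine ⟨(φ.relabel (Sum.elim (fun n => Nat.casesOn n (Sum.inr ()) (fun m => Sum.inl (Sum.inl m)))
    (fun c => Sum.inl (Sum.inr c))) : setLang.Formula ((ℕ ⊕ C) ⊕ Unit)).iExs Unit, fun v => ?_⟩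
  have key : ∀ x : M, P v x ↔ φ.Realize (Sum.elim (scons x v) (fun c : C => (c : M))) := fun x => by
    rw [hφ]; rfl
  simp only [Formula.realize_iExs, Formula.realize_relabel]
  have aux : ∀ i : Unit → M, (Sum.elim (Sum.elim v fun c : C => (c : M)) i ∘
      Sum.elim (fun n => Nat.casesOn n (Sum.inr ()) (fun m => Sum.inl (Sum.inl m)))
        (fun c => Sum.inl (Sum.inr c))) = Sum.elim (scons (i ()) v) (fun c : C => (c : M)) := fun i => by
    funext x
    rcases x with (_ | n) | c <;> rfl
  simp only [aux, key]
  exact ⟨fun ⟨i, hi⟩ => ⟨i (), hi⟩, fun ⟨x, hx⟩ => ⟨fun _ => x, hx⟩⟩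

instance Def.forall {P : (ℕ → M) → M → Prop} [h : Def C (fun v => P (fun n => v (n + 1)) (v 0))] :
    Def C (fun v => ∀ x, P v x) :=
  (inferInstance : Def C (fun v => ¬ ∃ x, ¬ P v x)).congr fun v => by simp

theorem Def.eq_var (m n : ℕ) : Def C (fun v => v m = v n) :=
  ⟨(Term.var (Sum.inl m)).equal (Term.var (Sum.inl n)), fun v => by simp⟩

theorem Def.mem_var (m n : ℕ) : Def C (fun v => v m ∊ v n) := by
  let R : setLang.Relations 2 := SetRel.mem
  exact ⟨R.formula₂ (Term.var (Sum.inl m)) (Term.var (Sum.inl n)), fun v => Formula.realize_rel₂⟩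

/-- A term with definable graph is eliminated by an existential quantifier over its value. -/
theorem Def.subst {P : (ℕ → M) → M → Prop} (h : Def C (fun v => P (fun n => v (n + 1)) (v 0)))
    {t : (ℕ → M) → M} (ht : DefT C t) : Def C (fun v => P v (t v)) := by
  have := ht.out
  exact (inferInstance : Def C (fun v => ∃ x, x = t v ∧ P v x)).congr fun v => by simp

theorem Def.subst₁ {P : M → Prop} (h : Def C (fun v => P (v 0)))
    {t : (ℕ → M) → M} (ht : DefT C t) : Def C (fun v => P (t v)) :=
  Def.subst (P := fun _ x => P x) h ht

theorem DefT.shift {t : (ℕ → M) → M} (ht : DefT C t) (f : ℕ → ℕ) :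
    DefT C (fun v => t (fun n => v (f n))) :=
  ⟨ht.out.relabel (fun n => Nat.casesOn n 0 (fun m => f m + 1))⟩

theorem Def.subst₂ {P : M → M → Prop} (h : Def C (fun v => P (v 0) (v 1)))
    {s t : (ℕ → M) → M} (hs : DefT C s) (ht : DefT C t) : Def C (fun v => P (s v) (t v)) := by
  have h1 : Def C (fun v : ℕ → M => P (v 0) (t (fun n => v (n + 1)))) :=
    Def.subst (P := fun v y => P (v 0) y) (h.relabel (fun n => Nat.casesOn n 1 fun _ => 0))
      (ht.shift (· + 1))
  exact Def.subst (P := fun v x => P x (t v)) h1 hs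

instance DefT.var (n : ℕ) : DefT C (fun v => v n) := ⟨Def.eq_var 0 (n + 1)⟩

instance DefT.const (c : M) : DefT Set.univ (fun _ => c) :=
  ⟨⟨(Term.var (Sum.inl 0)).equal (Term.var (Sum.inr ⟨c, trivial⟩)), fun v => by simp⟩⟩

theorem DefT.subst₁ {g : M → M} (h : DefT C (fun v => g (v 0)))
    {t : (ℕ → M) → M} (ht : DefT C t) : DefT C (fun v => g (t v)) :=
  ⟨Def.subst₂ (P := fun x y => y = g x) (h.out.relabel (fun n => Nat.casesOn n 1 fun _ => 0))
    (ht.shift (· + 1)) (DefT.var 0)⟩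

theorem DefT.subst₂ {g : M → M → M} (h : DefT C (fun v => g (v 0) (v 1)))
    {s t : (ℕ → M) → M} (hs : DefT C s) (ht : DefT C t) : DefT C (fun v => g (s v) (t v)) := by
  refine ⟨?_⟩
  have h0 : Def C (fun v : ℕ → M => v 1 = g (v 0) (t (fun n => v (n + 2)))) :=
    Def.subst (P := fun v y => v 1 = g (v 0) y)
      (h.out.relabel (fun n => Nat.casesOn n 2 (fun m => Nat.casesOn m 1 fun _ => 0)))
      (ht.shift (· + 2))
  exact Def.subst (P := fun v x => v 0 = g x (t (fun n => v (n + 1)))) h0 (hs.shift (· + 1))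

instance Def.mem {s t : (ℕ → M) → M} [hs : DefT C s] [ht : DefT C t] :
    Def C (fun v => s v ∊ t v) := Def.subst₂ (Def.mem_var 0 1) hs ht

instance Def.eq {s t : (ℕ → M) → M} [hs : DefT C s] [ht : DefT C t] :
    Def C (fun v => s v = t v) := Def.subst₂ (Def.eq_var 0 1) hs ht

instance Def.existsUnique {P : (ℕ → M) → M → Prop}
    [h : Def C (fun v => P (fun n => v (n + 1)) (v 0))] : Def C (fun v => ∃! x, P v x) := by
  have h1 : Def C (fun v : ℕ → M => P (fun n => v (n + 1 + 1)) (v 0)) :=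
    h.relabel (fun n => Nat.casesOn n 0 fun m => m + 2)
  exact (inferInstance : Def C (fun v => ∃ x, P v x ∧ ∀ y, P v y → y = x)).congr fun v => Iff.rfl

instance Def.isSubset {s t : (ℕ → M) → M} [hs : DefT C s] [ht : DefT C t] :
    Def C (fun v => IsSubset (s v) (t v)) :=
  Def.subst₂ (by unfold IsSubset; infer_instance) hs ht

theorem Def.subst₃ {P : M → M → M → Prop} (h : Def C (fun v => P (v 0) (v 1) (v 2)))
    {r s t : (ℕ → M) → M} (hr : DefT C r) (hs : DefT C s) (ht : DefT C t) :
    Def C (fun v => P (r v) (s v) (t v)) := by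
  have h1 : Def C (fun v : ℕ → M => P (v 0) (v 1) (t (fun n => v (n + 2)))) :=
    Def.subst (P := fun v y => P (v 0) (v 1) y)
      (h.relabel (fun n => Nat.casesOn n 1 fun n => Nat.casesOn n 2 fun _ => 0))
      (ht.shift (· + 2))
  have h2 : Def C (fun v : ℕ → M => P (v 0) (s (fun n => v (n + 1))) (t (fun n => v (n + 1)))) :=
    Def.subst (P := fun v y => P (v 0) y (t (fun n => v (n + 1))))
      (h1.relabel (fun n => Nat.casesOn n 1 fun n => Nat.casesOn n 0 fun n => n + 2))
      (hs.shift (· + 1))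
  exact Def.subst (P := fun v x => P x (s v) (t v)) h2 hr

end Definability

/-! ## Set formation in a transitive model -/

section Basic

variable {M : Set ZFSet.{u}}

theorem mem_def (x y : M) : x ∊ y ↔ (x : ZFSet.{u}) ∈ (y : ZFSet.{u}) := Iff.rfl

theorem mem_wf : WellFounded (fun x y : M => x ∊ y) := InvImage.wf Subtype.val ZFSet.mem_wf

theorem mem_irrefl (x : M) : ¬ x ∊ x := ZFSet.mem_irrefl _

theorem mem_asymm {x y : M} (h : x ∊ y) : ¬ y ∊ x := ZFSet.mem_asymm h

/-- Membership in M is true membership, so minimal elements exist for arbitrary predicates,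
definable or not. -/
theorem exists_minimal (P : M → Prop) {x : M} (hx : P x) : ∃ y, P y ∧ ∀ z, z ∊ y → ¬ P z := by
  obtain ⟨y, hy, h⟩ := mem_wf.has_min {x | P x} ⟨x, hx⟩
  exact ⟨y, hy, fun z hz hP => h z hP hz⟩

/-- The schemas want finitely many parameters. All free variables and constants of the formula are
numbered and packed into one tuple; variables other than the first two get the dummy value `c`. -/
theorem Def.exists_formula {Q : M → M → Prop} (h : Def Set.univ (fun v : ℕ → M => Q (v 0) (v 1)))
    (c : M) : ∃ (n : ℕ) (φ : setLang.Formula (Fin (n + 2))) (p : Fin n → M), ∀ x y,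
      φ.Realize (Fin.cons x (Fin.cons y p) : Fin (n + 2) → M) ↔ Q x y := by
  classical
  obtain ⟨φ, hφ⟩ := h.out
  let e := (BoundedFormula.freeVarFinset φ).equivFin
  refine ⟨_, BoundedFormula.restrictFreeVar φ (fun a => match a.1 with
    | Sum.inl 0 => 0
    | Sum.inl 1 => 1
    | _ => (e a).succ.succ),
    fun i => Sum.elim (fun _ => c) (fun c : (Set.univ : Set M) => (c : M)) (e.symm i).1,
    fun x y => ?_⟩
  rw [← show _ ↔ Q x y from hφ (scons x (scons y fun _ => c))]
  refine BoundedFormula.realize_restrictFreeVar _ fun a => ?_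
  rcases a with ⟨(_ | _ | n) | m, ha⟩
  · rfl
  · rfl
  · simp [scons]
  · simp

variable [hM : Fact (IsTransitiveModelZFC M)]

theorem ext {x y : M} (h : ∀ z, z ∊ x ↔ z ∊ y) : x = y := hM.out.2.extensionality x y h

theorem exists_sep (P : M → Prop) [h : Def Set.univ (fun v : ℕ → M => P (v 0))] (a : M) :
    ∃ b : M, ∀ x, x ∊ b ↔ x ∊ a ∧ P x := by
  obtain ⟨n, φ, p, hφ⟩ := Def.exists_formula (Q := fun x _ => P x) h a
  obtain ⟨b, hb⟩ := hM.out.2.separation (n + 1) φ (Fin.cons a p) a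
  exact ⟨b, fun x => by rw [hb, hφ]⟩

theorem exists_image (Q : M → M → Prop) [h : Def Set.univ (fun v : ℕ → M => Q (v 0) (v 1))] (a : M)
    (hQ : ∀ x y y', x ∊ a → Q x y → Q x y' → y = y') :
    ∃ b : M, ∀ y, y ∊ b ↔ ∃ x, x ∊ a ∧ Q x y := by
  obtain ⟨n, φ, p, hφ⟩ := Def.exists_formula h a
  obtain ⟨b, hb⟩ := hM.out.2.replacement n φ p a
    (fun x y y' hx h1 h2 => hQ x y y' hx ((hφ x y).1 h1) ((hφ x y').1 h2))
  exact ⟨b, fun y => by rw [hb]; simp_rw [hφ]⟩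

theorem exists_empty : ∃ e : M, ∀ z, ¬ z ∊ e := by
  obtain ⟨w, ⟨e, -, he⟩, -⟩ := hM.out.2.infinity
  exact ⟨e, he⟩

open Classical in
/-- The unique `y` with `P y` if there is one, and the empty set otherwise. -/
noncomputable def the (P : M → Prop) : M :=
  if h : ∃! y, P y then h.choose else exists_empty.choose

theorem the_eq {P : M → Prop} {y : M} (hy : P y) (hu : ∀ z, P z → z = y) : the P = y := by
  have h : ∃! y, P y := ⟨y, hy, hu⟩
  rw [the, dif_pos h]
  exact hu _ h.choose_spec.1

theorem the_spec {P : M → Prop} (h : ∃! y, P y) : P (the P) := by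
  rw [the, dif_pos h]
  exact h.choose_spec.1

/-- The default value is itself described by a formula (it has no members), so `the` has a definable
graph whether or not the description succeeds. -/
theorem eq_the_iff (P : M → Prop) (y : M) :
    y = the P ↔ (P y ∧ ∀ z, P z → z = y) ∨ ((¬ ∃! y, P y) ∧ ∀ z, ¬ z ∊ y) := by
  by_cases h : ∃! y, P y
  · constructor
    · rintro rfl
      exact Or.inl ⟨the_spec h, fun z hz => h.unique hz (the_spec h)⟩
    · rintro (⟨h1, h2⟩ | ⟨h1, -⟩)
      · exact (the_eq h1 h2).symm
      · exact (h1 h).elim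
  · rw [the, dif_neg h]
    constructor
    · rintro rfl
      exact Or.inr ⟨h, exists_empty.choose_spec⟩
    · rintro (⟨h1, h2⟩ | ⟨-, h2⟩)
      · exact (h ⟨y, h1, h2⟩).elim
      · exact ext fun z => iff_of_false (h2 z) (exists_empty.choose_spec z)

variable {C : Set M}

instance DefT.the {P : (ℕ → M) → M → Prop} [h : Def C (fun v => P (fun n => v (n + 1)) (v 0))] :
    DefT C (fun v => the (P v)) := by
  have h1 : Def C (fun v : ℕ → M => P (fun n => v (n + 1 + 1)) (v 0)) :=
    h.relabel (fun n => Nat.casesOn n 0 fun m => m + 2)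
  exact ⟨(inferInstance : Def C (fun v : ℕ → M =>
    (P (fun n => v (n + 1)) (v 0) ∧ ∀ z, P (fun n => v (n + 1)) z → z = v 0) ∨
    ((¬ ∃! y, P (fun n => v (n + 1)) y) ∧ ∀ z, ¬ z ∊ v 0))).congr
    fun v => (eq_the_iff _ _).symm⟩

/-- The set `{z | Q z}`, if it exists. -/
noncomputable def cls (Q : M → Prop) : M := the (fun y => ∀ z, z ∊ y ↔ Q z)

instance DefT.cls {P : (ℕ → M) → M → Prop} [h : Def C (fun v => P (fun n => v (n + 1)) (v 0))] :
    DefT C (fun v => cls (P v)) := by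
  have h1 : Def C (fun v : ℕ → M => P (fun n => v (n + 1 + 1)) (v 0)) :=
    h.relabel (fun n => Nat.casesOn n 0 fun m => m + 2)
  exact (inferInstance : DefT C (fun v => SetModel.the (fun y => ∀ z, z ∊ y ↔ P v z)))

theorem mem_cls_of_exists {Q : M → Prop} (h : ∃ b : M, ∀ z, z ∊ b ↔ Q z) (z : M) :
    z ∊ cls Q ↔ Q z := by
  obtain ⟨b, hb⟩ := h
  have : cls Q = b := the_eq hb fun c hc => ext fun z => by rw [hb, hc]
  rw [this, hb]

theorem mem_cls {Q : M → Prop} [Def Set.univ (fun v : ℕ → M => Q (v 0))] (a : M)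
    (ha : ∀ z, Q z → z ∊ a) (z : M) : z ∊ cls Q ↔ Q z := by
  obtain ⟨b, hb⟩ := exists_sep Q a
  exact mem_cls_of_exists ⟨b, fun z => by rw [hb]; exact ⟨fun h => h.2, fun h => ⟨ha z h, h⟩⟩⟩ z

theorem mem_sep {Q : M → Prop} {a : M} [h : Def Set.univ (fun v : ℕ → M => Q (v 0))] (z : M) :
    z ∊ cls (fun z => z ∊ a ∧ Q z) ↔ z ∊ a ∧ Q z := mem_cls a (fun _ h => h.1) z

/-- The empty set. -/
noncomputable def emp : M := cls fun _ => False

theorem not_mem_emp (z : M) : ¬ z ∊ (emp : M) := by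
  have := mem_cls_of_exists (Q := fun _ : M => False) (by
    obtain ⟨e, he⟩ := exists_empty (M := M)
    exact ⟨e, fun z => ⟨he z, False.elim⟩⟩) z
  exact this.1

/-- The unordered pair. -/
noncomputable def upair (x y : M) : M := cls fun z => z = x ∨ z = y

theorem mem_upair (x y z : M) : z ∊ upair x y ↔ z = x ∨ z = y :=
  mem_cls_of_exists (hM.out.2.pairing x y) z

instance {s t : (ℕ → M) → M} [hs : DefT C s] [ht : DefT C t] :
    DefT C (fun v => upair (s v) (t v)) :=
  DefT.subst₂ (by unfold upair; infer_instance) hs ht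

theorem isUPair_iff {p x y : M} : IsUPair p x y ↔ p = upair x y :=
  ⟨fun h => ext fun z => by rw [h, mem_upair], fun h z => by rw [h, mem_upair]⟩

/-- The union of a set. -/
noncomputable def sUnion (x : M) : M := cls fun z => ∃ w, w ∊ x ∧ z ∊ w

theorem mem_sUnion (x z : M) : z ∊ sUnion x ↔ ∃ w, w ∊ x ∧ z ∊ w :=
  mem_cls_of_exists (hM.out.2.union x) z

instance {s : (ℕ → M) → M} [hs : DefT C s] : DefT C (fun v => sUnion (s v)) :=
  DefT.subst₁ (by unfold sUnion; infer_instance) hs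

/-- The power set. -/
noncomputable def pow (x : M) : M := cls fun z => IsSubset z x

theorem mem_pow (x z : M) : z ∊ pow x ↔ IsSubset z x := mem_cls_of_exists (hM.out.2.powerset x) z

instance {s : (ℕ → M) → M} [hs : DefT C s] : DefT C (fun v => pow (s v)) :=
  DefT.subst₁ (by unfold pow; infer_instance) hs

/-- The binary union. -/
noncomputable def bun (x y : M) : M := cls fun z => z ∊ x ∨ z ∊ y

theorem mem_bun (x y z : M) : z ∊ bun x y ↔ z ∊ x ∨ z ∊ y := by
  refine mem_cls (sUnion (upair x y)) (fun z hz => ?_) z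
  rw [mem_sUnion]
  rcases hz with hz | hz
  · exact ⟨x, (mem_upair _ _ _).2 (Or.inl rfl), hz⟩
  · exact ⟨y, (mem_upair _ _ _).2 (Or.inr rfl), hz⟩

instance {s t : (ℕ → M) → M} [hs : DefT C s] [ht : DefT C t] :
    DefT C (fun v => bun (s v) (t v)) :=
  DefT.subst₂ (by unfold bun; infer_instance) hs ht

/-- The binary intersection. -/
noncomputable def inter (x y : M) : M := cls fun z => z ∊ x ∧ z ∊ y

theorem mem_inter (x y z : M) : z ∊ inter x y ↔ z ∊ x ∧ z ∊ y := mem_sep z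

instance {s t : (ℕ → M) → M} [hs : DefT C s] [ht : DefT C t] :
    DefT C (fun v => inter (s v) (t v)) :=
  DefT.subst₂ (by unfold inter; infer_instance) hs ht

/-- The ordered pair. -/
noncomputable def op (x y : M) : M := upair (upair x x) (upair x y)

instance {s t : (ℕ → M) → M} [hs : DefT C s] [ht : DefT C t] :
    DefT C (fun v => op (s v) (t v)) := by unfold op; infer_instance

theorem upair_val (x y : M) : (upair x y : ZFSet.{u}) = {(x : ZFSet.{u}), (y : ZFSet.{u})} := by
  ext z
  rw [ZFSet.mem_pair]
  constructor
  · intro hz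
    have := (mem_upair x y ⟨z, hM.out.1 _ (upair x y).2 z hz⟩).1 hz
    simpa [Subtype.ext_iff] using this
  · rintro (rfl | rfl)
    · exact (mem_upair x y x).2 (Or.inl rfl)
    · exact (mem_upair x y y).2 (Or.inr rfl)

theorem op_inj {x y x' y' : M} : op x y = op x' y' ↔ x = x' ∧ y = y' := by
  rw [Subtype.ext_iff, Subtype.ext_iff (a1 := x), Subtype.ext_iff (a1 := y), ← ZFSet.pair_inj]
  simp only [op, upair_val, ZFSet.pair]
  simp

theorem isOPair_iff {p x y : M} : IsOPair p x y ↔ p = op x y := by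
  simp only [IsOPair, isUPair_iff]
  constructor
  · rintro ⟨s, t, rfl, rfl, rfl⟩
    rfl
  · rintro rfl
    exact ⟨_, _, rfl, rfl, rfl⟩

theorem app_iff {f x y : M} : App f x y ↔ op x y ∊ f := by simp [App, isOPair_iff]

instance {r s t : (ℕ → M) → M} [hr : DefT C r] [hs : DefT C s] [ht : DefT C t] :
    Def C (fun v => App (r v) (s v) (t v)) :=
  (inferInstance : Def C (fun v => op (s v) (t v) ∊ r v)).congr fun _ => app_iff.symm

/-- The Cartesian product. -/
noncomputable def prod (a b : M) : M := cls fun p => ∃ x y, x ∊ a ∧ y ∊ b ∧ p = op x y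

theorem mem_prod (a b p : M) : p ∊ prod a b ↔ ∃ x y, x ∊ a ∧ y ∊ b ∧ p = op x y := by
  refine mem_cls (pow (pow (bun a b))) ?_ p
  rintro _ ⟨x, y, hx, hy, rfl⟩
  rw [mem_pow]
  intro z hz
  rw [mem_pow]
  intro w hw
  rw [mem_bun]
  rcases (mem_upair _ _ _).1 hz with rfl | rfl <;>
    rcases (mem_upair _ _ _).1 hw with rfl | rfl <;> simp [hx, hy]

theorem op_mem_prod {a b x y : M} : op x y ∊ prod a b ↔ x ∊ a ∧ y ∊ b := by
  rw [mem_prod]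
  constructor
  · rintro ⟨x', y', hx, hy, h⟩
    obtain ⟨rfl, rfl⟩ := op_inj.1 h
    exact ⟨hx, hy⟩
  · rintro ⟨hx, hy⟩
    exact ⟨x, y, hx, hy, rfl⟩

instance {s t : (ℕ → M) → M} [hs : DefT C s] [ht : DefT C t] :
    DefT C (fun v => prod (s v) (t v)) :=
  DefT.subst₂ (by unfold prod; infer_instance) hs ht

/-- The value of the function `f` at `x`. -/
noncomputable def ap (f x : M) : M := the fun y => op x y ∊ f

instance {s t : (ℕ → M) → M} [hs : DefT C s] [ht : DefT C t] :
    DefT C (fun v => ap (s v) (t v)) :=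
  DefT.subst₂ (by unfold ap; infer_instance) hs ht

theorem IsFunOn.app_iff {f a x y : M} (hf : IsFunOn f a) (hx : x ∊ a) :
    App f x y ↔ y = ap f x := by
  obtain ⟨z, hz, hu⟩ := hf.2 x hx
  have : ap f x = z := the_eq (SetModel.app_iff.1 hz) fun w hw => hu w (SetModel.app_iff.2 hw)
  rw [this]
  exact ⟨hu y, fun h => h ▸ hz⟩

theorem IsFunOn.app_iff' {f a x y : M} (hf : IsFunOn f a) :
    App f x y ↔ x ∊ a ∧ y = ap f x := by
  constructor
  · intro h
    have hx : x ∊ a := by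
      obtain ⟨x', y', hx', hp⟩ := hf.1 _ (SetModel.app_iff.1 h)
      rwa [(op_inj.1 (isOPair_iff.1 hp)).1]
    exact ⟨hx, (hf.app_iff hx).1 h⟩
  · exact fun h => (hf.app_iff h.1).2 h.2

/-- The function `x ↦ G x` with domain `a`. -/
noncomputable def lam (a : M) (G : M → M) : M := cls fun p => ∃ x, x ∊ a ∧ p = op x (G x)

section lam

variable {a : M} {G : M → M} [hG : DefT Set.univ (fun v : ℕ → M => G (v 0))]

theorem mem_lam (p : M) : p ∊ lam a G ↔ ∃ x, x ∊ a ∧ p = op x (G x) := by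
  have : Def Set.univ (fun v : ℕ → M => v 1 = op (v 0) (G (v 0))) := inferInstance
  exact mem_cls_of_exists (exists_image (fun x p => p = op x (G x)) a
    (fun x y y' _ h h' => h.trans h'.symm)) p

theorem app_lam {x y : M} : App (lam a G) x y ↔ x ∊ a ∧ y = G x := by
  rw [app_iff, mem_lam]
  constructor
  · rintro ⟨x', hx, h⟩
    obtain ⟨rfl, rfl⟩ := op_inj.1 h
    exact ⟨hx, rfl⟩
  · rintro ⟨hx, rfl⟩
    exact ⟨x, hx, rfl⟩

theorem isFunOn_lam : IsFunOn (lam a G) a := by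
  constructor
  · intro p hp
    obtain ⟨x, hx, rfl⟩ := (mem_lam p).1 hp
    exact ⟨x, G x, hx, isOPair_iff.2 rfl⟩
  · intro x hx
    exact ⟨G x, app_lam.2 ⟨hx, rfl⟩, fun y hy => (app_lam.1 hy).2⟩

theorem ap_lam {x : M} (hx : x ∊ a) : ap (lam a G) x = G x :=
  ((isFunOn_lam.app_iff hx).1 (app_lam.2 ⟨hx, rfl⟩)).symm

end lam

/-- The image `{G x | x ∊ a}`. -/
noncomputable def image (a : M) (G : M → M) : M := cls fun y => ∃ x, x ∊ a ∧ y = G x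

instance DefT.image {s : (ℕ → M) → M} {G : (ℕ → M) → M → M} [hs : DefT C s]
    [h : DefT C (fun v => G (fun n => v (n + 1)) (v 0))] : DefT C (fun v => image (s v) (G v)) := by
  have h1 : DefT C (fun v : ℕ → M => G (fun n => v (n + 1 + 1)) (v 0)) :=
    h.shift (fun n => Nat.casesOn n 0 fun m => m + 2)
  have h2 : DefT C (fun v : ℕ → M => s (fun n => v (n + 1 + 1))) := hs.shift _
  exact (inferInstance : DefT C (fun v => SetModel.cls fun y => ∃ x, x ∊ s v ∧ y = G v x))

theorem mem_image {a : M} {G : M → M} [hG : DefT Set.univ (fun v : ℕ → M => G (v 0))] (y : M) :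
    y ∊ image a G ↔ ∃ x, x ∊ a ∧ y = G x := by
  have : Def Set.univ (fun v : ℕ → M => v 1 = G (v 0)) := inferInstance
  exact mem_cls_of_exists (exists_image (fun x p => p = G x) a
    (fun x y y' _ h h' => h.trans h'.symm)) y

/-- The successor `x ∪ {x}`. -/
noncomputable def suc (x : M) : M := bun x (upair x x)

instance {s : (ℕ → M) → M} [hs : DefT C s] : DefT C (fun v => suc (s v)) := by
  unfold suc; infer_instance

theorem mem_suc (x z : M) : z ∊ suc x ↔ z ∊ x ∨ z = x := by
  rw [suc, mem_bun, mem_upair, or_self]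

/-- A choice function for the nonempty subsets of `b`. -/
theorem exists_choice (b : M) : ∃ e : M, ∀ s, IsSubset s b → (∃ z, z ∊ s) → ap e s ∊ s := by
  -- The axiom of choice is stated for disjoint families, so each nonempty s ⊆ b is replaced by {s}
  -- × s.
  let F : M := image (cls fun s => s ∊ pow b ∧ ∃ z, z ∊ s) (fun s => prod (upair s s) s)
  have hF : ∀ x, x ∊ F ↔ ∃ s, (IsSubset s b ∧ ∃ z, z ∊ s) ∧ x = prod (upair s s) s := fun x => by
    rw [mem_image]
    exact exists_congr fun s => and_congr_left fun _ => by rw [mem_sep, mem_pow]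
  obtain ⟨c, hc⟩ := hM.out.2.choice F (by
    intro x hx
    obtain ⟨s, ⟨-, z, hz⟩, rfl⟩ := (hF x).1 hx
    exact ⟨op s z, op_mem_prod.2 ⟨(mem_upair _ _ _).2 (Or.inl rfl), hz⟩⟩) (by
    intro x y z hx hy hzx hzy
    obtain ⟨s, -, rfl⟩ := (hF x).1 hx
    obtain ⟨t, -, rfl⟩ := (hF y).1 hy
    obtain ⟨a1, b1, ha1, -, h1⟩ := (mem_prod _ _ _).1 hzx
    obtain ⟨a2, b2, ha2, -, h2⟩ := (mem_prod _ _ _).1 hzy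
    obtain ⟨h3, -⟩ := op_inj.1 (h1.symm.trans h2)
    simp only [mem_upair, or_self] at ha1 ha2
    rw [← ha1, ← ha2, h3])
  refine ⟨lam (pow b) fun s => the fun z => z ∊ s ∧ op s z ∊ c, fun s hs hne => ?_⟩
  rw [ap_lam ((mem_pow _ _).2 hs)]
  obtain ⟨p, ⟨hp, hpc⟩, hu⟩ := hc _ ((hF _).2 ⟨s, ⟨hs, hne⟩, rfl⟩)
  obtain ⟨s', z, hs', hz, rfl⟩ := (mem_prod _ _ _).1 hp
  simp only [mem_upair, or_self] at hs'
  subst hs'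
  refine (the_spec (P := fun z => z ∊ s' ∧ op s' z ∊ c) ⟨z, ⟨hz, hpc⟩, fun w hw => ?_⟩).1
  exact (op_inj.1 (hu (op s' w) ⟨op_mem_prod.2 ⟨(mem_upair _ _ _).2 (Or.inl rfl), hw.1⟩, hw.2⟩)).2

theorem exists_choice_fun (Q : M → M → Prop)
    [hQ : Def Set.univ (fun v : ℕ → M => Q (v 0) (v 1))] (a b : M) :
    ∃ f : M, IsFunOn f a ∧ ∀ x, x ∊ a → (∃ y, y ∊ b ∧ Q x y) → ap f x ∊ b ∧ Q x (ap f x) := by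
  obtain ⟨e, he⟩ := exists_choice b
  have : Def Set.univ (fun v : ℕ → M => Q (v 1) (v 0)) := Def.subst₂ hQ (.var 1) (.var 0)
  have hx' (x : M) : Def Set.univ (fun v : ℕ → M => Q x (v 0)) := Def.subst₂ hQ (.const x) (.var 0)
  refine ⟨lam a fun x => ap e (cls fun y => y ∊ b ∧ Q x y), isFunOn_lam, fun x hx hy => ?_⟩
  rw [ap_lam hx, ← mem_sep (Q := Q x)]
  refine he _ (fun y hy => ((mem_sep (Q := Q x) y).1 hy).1) ?_
  obtain ⟨y, hy⟩ := hy
  exact ⟨y, (mem_sep (Q := Q x) y).2 hy⟩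

end Basic

/-! ## Ordinals, definability of the basic notions, recursion -/

section DefInst

variable {M : Set ZFSet.{u}} {C : Set M}

section

variable {r s t : (ℕ → M) → M} [hr : DefT C r] [hs : DefT C s] [ht : DefT C t]

instance : Def C (fun v => IsTrans (s v)) :=
  Def.subst₁ (by unfold IsTrans; infer_instance) hs

instance : Def C (fun v => IsOrd (s v)) := Def.subst₁ (by unfold IsOrd; infer_instance) hs

instance : Def C (fun v => IsPower (s v) (t v)) :=
  Def.subst₂ (by unfold IsPower; infer_instance) hs ht

end

variable [hM : Fact (IsTransitiveModelZFC M)]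

section

variable {r s t : (ℕ → M) → M} [hr : DefT C r] [hs : DefT C s] [ht : DefT C t]

instance : Def C (fun v => IsUPair (r v) (s v) (t v)) :=
  (inferInstance : Def C (fun v => r v = upair (s v) (t v))).congr fun _ => isUPair_iff.symm

instance : Def C (fun v => IsOPair (r v) (s v) (t v)) :=
  (inferInstance : Def C (fun v => r v = op (s v) (t v))).congr fun _ => isOPair_iff.symm

instance : Def C (fun v => IsFunOn (s v) (t v)) :=
  Def.subst₂ (by unfold IsFunOn; infer_instance) hs ht

instance : Def C (fun v => IsFun (r v) (s v) (t v)) :=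
  Def.subst₃ (by unfold IsFun; infer_instance) hr hs ht

instance : Def C (fun v => IsBij (r v) (s v) (t v)) :=
  Def.subst₃ (by unfold IsBij; infer_instance) hr hs ht

instance : Def C (fun v => IsCardOf (s v) (t v)) :=
  Def.subst₂ (by unfold IsCardOf; infer_instance) hs ht

instance : Def C (fun v => IsCard (s v)) := by unfold IsCard; infer_instance

instance : Def C (fun v => IsSuccCard (s v) (t v)) :=
  Def.subst₂ (by unfold IsSuccCard; infer_instance) hs ht

instance : Def C (fun v => IsSuccTwoPow (s v) (t v)) :=
  Def.subst₂ (by unfold IsSuccTwoPow; infer_instance) hs ht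

instance : Def C (fun v => IsUltrafilter (s v) (t v)) :=
  Def.subst₂ (by unfold IsUltrafilter; infer_instance) hs ht

instance : Def C (fun v => IsNormalMeasure (s v) (t v)) :=
  Def.subst₂ (by unfold IsNormalMeasure; infer_instance) hs ht

end

instance Def.memMod {q r s t : (ℕ → M) → M} [hq : DefT C q] [hr : DefT C r] [hs : DefT C s]
    [ht : DefT C t] : Def C (fun v => MemMod (q v) (r v) (s v) (t v)) := by
  have hq' := fun f => hq.shift f
  have hr' := fun f => hr.shift f
  have hs' := fun f => hs.shift f
  have ht' := fun f => ht.shift f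
  unfold MemMod
  infer_instance

instance Def.eqMod {q r s t : (ℕ → M) → M} [hq : DefT C q] [hr : DefT C r] [hs : DefT C s]
    [ht : DefT C t] : Def C (fun v => EqMod (q v) (r v) (s v) (t v)) := by
  have hq' := fun f => hq.shift f
  have hr' := fun f => hr.shift f
  have hs' := fun f => hs.shift f
  have ht' := fun f => ht.shift f
  unfold EqMod
  infer_instance

variable {r s t : (ℕ → M) → M} [hr : DefT C r] [hs : DefT C s] [ht : DefT C t]

instance Def.inUlt : Def C (fun v => InUlt (r v) (s v) (t v)) :=
  Def.subst₃ (by unfold InUlt IsCollapse; infer_instance) hr hs ht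

instance : Def C (fun v => IsMitchellHeight (s v) (t v)) :=
  Def.subst₂ (by unfold IsMitchellHeight; infer_instance) hs ht

instance : Def C (fun v => MitchellMaximal (s v)) :=
  Def.subst₁ (by unfold MitchellMaximal; infer_instance) hs

instance : Def C (fun v => UltsCaptureAll (s v)) :=
  Def.subst₁ (by unfold UltsCaptureAll; infer_instance) hs

end DefInst

/-! ### Ordinals of a transitive model. -/

section Ordinals

variable {M : Set ZFSet.{u}}

theorem IsOrd.mem_trans {x y z : M} (h : IsOrd x) (hy : y ∊ x) (hz : z ∊ y) : z ∊ x := h.1 y hy z hz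

theorem isOrd_of {x : M} (h : IsTrans x) (h' : ∀ y, y ∊ x → IsOrd y) : IsOrd x :=
  ⟨h, fun y hy => (h' y hy).1⟩

variable [hM : Fact (IsTransitiveModelZFC M)]

theorem isSubset_iff {x y : M} : IsSubset x y ↔ (x : ZFSet.{u}) ⊆ (y : ZFSet.{u}) :=
  ⟨fun h z hz => h ⟨z, hM.out.1 _ x.2 z hz⟩ hz, fun h _ hz => h hz⟩

theorem isTrans_iff {x : M} : IsTrans x ↔ (x : ZFSet.{u}).IsTransitive := by
  simp only [IsTrans, isSubset_iff, ZFSet.IsTransitive]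
  exact ⟨fun h z hz => h ⟨z, hM.out.1 _ x.2 z hz⟩ hz, fun h z hz => h z hz⟩

theorem isOrd_iff {x : M} : IsOrd x ↔ (x : ZFSet.{u}).IsOrdinal := by
  rw [ZFSet.isOrdinal_iff_forall_mem_isTransitive, IsOrd, isTrans_iff]
  simp only [isTrans_iff]
  exact and_congr_right fun _ =>
    ⟨fun h z hz => h ⟨z, hM.out.1 _ x.2 z hz⟩ hz, fun h z hz => h z hz⟩

theorem IsSubset.antisymm {x y : M} (h : IsSubset x y) (h' : IsSubset y x) : x = y :=
  ext fun z => ⟨h z, h' z⟩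

theorem IsOrd.mem {x y : M} (h : IsOrd x) (hy : y ∊ x) : IsOrd y :=
  isOrd_iff.2 ((isOrd_iff.1 h).mem hy)

theorem IsOrd.trichotomy {x y : M} (hx : IsOrd x) (hy : IsOrd y) : x ∊ y ∨ x = y ∨ y ∊ x := by
  rw [Subtype.ext_iff]
  exact (isOrd_iff.1 hx).mem_trichotomous (isOrd_iff.1 hy)

theorem IsOrd.mem_or_subset {x y : M} (hx : IsOrd x) (hy : IsOrd y) : x ∊ y ∨ IsSubset y x := by
  rcases hx.trichotomy hy with h | rfl | h
  · exact Or.inl h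
  · exact Or.inr fun _ h => h
  · exact Or.inr (hx.1 y h)

end Ordinals

/-! ### Recursion along relations well-founded in the model. -/

section Recursion

variable {M : Set ZFSet.{u}}

/-- The relation `R` is well-founded on `a`, in the sense of the model. -/
def WFOn (a : M) (R : M → M → Prop) : Prop :=
  ∀ S, IsSubset S a → (∃ x, x ∊ S) → ∃ x, x ∊ S ∧ ∀ y, y ∊ S → ¬ R y x

theorem wfOn_mem (a : M) : WFOn a (fun x y => x ∊ y) := by
  rintro S - ⟨x, hx⟩
  obtain ⟨y, hy, h⟩ := exists_minimal (· ∊ S) hx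
  exact ⟨y, hy, fun z hz hzy => h z hzy hz⟩

variable [hM : Fact (IsTransitiveModelZFC M)]

/-- The restriction of `f` to `s`. -/
noncomputable def restr (f s : M) : M := cls fun p => p ∊ f ∧ ∃ x y, x ∊ s ∧ p = op x y

instance {C : Set M} {s t : (ℕ → M) → M} [hs : DefT C s] [ht : DefT C t] :
    DefT C (fun v => restr (s v) (t v)) :=
  DefT.subst₂ (by unfold restr; infer_instance) hs ht

theorem op_mem_restr {f s x y : M} : op x y ∊ restr f s ↔ op x y ∊ f ∧ x ∊ s := by
  rw [restr, mem_sep]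
  constructor
  · rintro ⟨h, x', y', hx, hp⟩
    exact ⟨h, (op_inj.1 hp).1 ▸ hx⟩
  · exact fun h => ⟨h.1, x, y, h.2, rfl⟩

theorem restr_congr {f g a b s : M} (hf : IsFunOn f a) (hg : IsFunOn g b) (ha : IsSubset s a)
    (hb : IsSubset s b) (h : ∀ x, x ∊ s → ap f x = ap g x) : restr f s = restr g s := by
  refine ext fun p => ?_
  simp only [restr]
  rw [mem_sep, mem_sep]
  constructor
  · rintro ⟨hp, x, y, hx, rfl⟩
    refine ⟨?_, x, y, hx, rfl⟩
    rw [← app_iff, hf.app_iff (ha x hx)] at hp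
    rw [← app_iff, hg.app_iff (hb x hx), ← h x hx, hp]
  · rintro ⟨hp, x, y, hx, rfl⟩
    refine ⟨?_, x, y, hx, rfl⟩
    rw [← app_iff, hg.app_iff (hb x hx)] at hp
    rw [← app_iff, hf.app_iff (ha x hx), h x hx, hp]

theorem IsFunOn.app_restr {f a s x y : M} (hf : IsFunOn f a) (hs : IsSubset s a) :
    App (restr f s) x y ↔ x ∊ s ∧ y = ap f x := by
  rw [SetModel.app_iff, op_mem_restr, ← SetModel.app_iff, hf.app_iff']
  exact ⟨fun h => ⟨h.2, h.1.2⟩, fun h => ⟨⟨hs x h.1, h.2⟩, h.1⟩⟩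

theorem IsFunOn.restr {f a s : M} (hf : IsFunOn f a) (hs : IsSubset s a) :
    IsFunOn (restr f s) s := by
  constructor
  · intro p hp
    obtain ⟨-, x, y, hx, rfl⟩ := (mem_sep p).1 hp
    exact ⟨x, y, hx, isOPair_iff.2 rfl⟩
  · intro x hx
    exact ⟨_, (hf.app_restr hs).2 ⟨hx, rfl⟩, fun y hy => ((hf.app_restr hs).1 hy).2⟩

theorem WFOn.induction {a : M} {R : M → M → Prop} (h : WFOn a R) (P : M → Prop)
    [hP : Def Set.univ (fun v : ℕ → M => P (v 0))]
    (step : ∀ x, x ∊ a → (∀ y, y ∊ a → R y x → P y) → P x) : ∀ x, x ∊ a → P x := by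
  intro x hx
  by_contra hc
  obtain ⟨y, hy, hmin⟩ := h (cls fun z => z ∊ a ∧ ¬ P z)
    (fun z hz => ((mem_sep z).1 hz).1) ⟨x, (mem_sep x).2 ⟨hx, hc⟩⟩
  rw [mem_sep] at hy
  refine hy.2 (step y hy.1 fun z hz hzy => ?_)
  by_contra hPz
  exact hmin z ((mem_sep z).2 ⟨hz, hPz⟩) hzy

/-- The members of `a` below `x`. -/
noncomputable def pred (a : M) (R : M → M → Prop) (x : M) : M := cls fun y => y ∊ a ∧ R y x

/-- Approximations live on R-closed subsets of `a` and agree where they overlap, so they glue to a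
function on the set `B` of points they reach. Well-foundedness then forces `B` to be all of `a`.
Transitivity of `R` plays no role. -/
theorem exists_rec (a : M) (R : M → M → Prop) (H : M → M → M)
    [hR : Def Set.univ (fun v : ℕ → M => R (v 0) (v 1))]
    [hH : DefT Set.univ (fun v : ℕ → M => H (v 0) (v 1))] (hwf : WFOn a R) :
    ∃ f : M, IsFunOn f a ∧ ∀ x, x ∊ a → ap f x = H x (restr f (pred a R x)) := by
  have instR : ∀ (s t : (ℕ → M) → M) [DefT Set.univ s] [DefT Set.univ t],
    Def Set.univ (fun v => R (s v) (t v)) := fun s t hs ht => hR.subst₂ hs ht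
  have instH : ∀ (s t : (ℕ → M) → M) [DefT Set.univ s] [DefT Set.univ t],
    DefT Set.univ (fun v => H (s v) (t v)) := fun s t hs ht => hH.subst₂ hs ht
  have instP : ∀ (s : (ℕ → M) → M) [DefT Set.univ s],
    DefT Set.univ (fun v => pred a R (s v)) := fun s hs =>
      DefT.subst₁ (by unfold pred; infer_instance) hs
  have hpred : ∀ x y, y ∊ pred a R x ↔ y ∊ a ∧ R y x := fun x y => mem_sep y
  let App' : M → M → Prop := fun d g => IsSubset d a ∧ IsFunOn g d ∧
    ∀ x, x ∊ d → IsSubset (pred a R x) d ∧ ap g x = H x (restr g (pred a R x))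
  have happ : ∀ (s t : (ℕ → M) → M) [DefT Set.univ s] [DefT Set.univ t],
      Def Set.univ (fun v => App' (s v) (t v)) := fun s t hs ht =>
    Def.subst₂ (by simp only [App']; infer_instance) hs ht
  have huniq : ∀ d g d' g', App' d g → App' d' g' → ∀ x, x ∊ a → x ∊ d → x ∊ d' →
      ap g x = ap g' x := by
    intro d g d' g' h h'
    refine hwf.induction (fun x => x ∊ d → x ∊ d' → ap g x = ap g' x) ?_
    intro x _ ih hx hx'
    rw [(h.2.2 x hx).2, (h'.2.2 x hx').2, restr_congr h.2.1 h'.2.1 (h.2.2 x hx).1 (h'.2.2 x hx').1]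
    intro y hy
    have hy' := (hpred x y).1 hy
    exact ih y hy'.1 hy'.2 ((h.2.2 x hx).1 y hy) ((h'.2.2 x hx').1 y hy)
  let B : M := cls fun x => x ∊ a ∧ ∃ d g, App' d g ∧ x ∊ d
  have hB : ∀ x, x ∊ B ↔ x ∊ a ∧ ∃ d g, App' d g ∧ x ∊ d := fun x => mem_sep x
  let G : M → M := fun x => the fun y => ∃ d g, App' d g ∧ x ∊ d ∧ y = ap g x
  have hG : ∀ d g x, App' d g → x ∊ d → G x = ap g x := by
    intro d g x h hx
    refine the_eq ⟨d, g, h, hx, rfl⟩ ?_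
    rintro _ ⟨d', g', h', hx', rfl⟩
    exact huniq d' g' d g h' h x (h.1 x hx) hx' hx
  have instG : ∀ (s : (ℕ → M) → M) [DefT Set.univ s], DefT Set.univ (fun v => G (s v)) :=
    fun s hs => DefT.subst₁ (by simp only [G]; infer_instance) hs
  have hF : App' B (lam B G) := by
    refine ⟨fun x hx => ((hB x).1 hx).1, isFunOn_lam, fun x hx => ?_⟩
    obtain ⟨hxa, d, g, h, hxd⟩ := (hB x).1 hx
    have hsub : IsSubset (pred a R x) B := fun y hy =>
      (hB y).2 ⟨((hpred x y).1 hy).1, d, g, h, (h.2.2 x hxd).1 y hy⟩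
    refine ⟨hsub, ?_⟩
    rw [ap_lam hx, hG d g x h hxd, (h.2.2 x hxd).2,
      restr_congr h.2.1 (isFunOn_lam (a := B) (G := G)) (h.2.2 x hxd).1 hsub]
    intro y hy
    rw [ap_lam (hsub y hy), hG d g y h ((h.2.2 x hxd).1 y hy)]
  have hall : ∀ x, x ∊ a → x ∊ B := by
    refine hwf.induction (fun x => x ∊ B) ?_
    intro x hx ih
    by_contra hxB
    have hsub : IsSubset (pred a R x) B := fun y hy =>
      ih y ((hpred x y).1 hy).1 ((hpred x y).1 hy).2
    -- All predecessors of `x` are in `B`, so adding `x` keeps the domain closed and gives an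
    -- approximation reaching `x`.
    let B' := bun B (upair x x)
    let F' := lam B' fun z => H z (restr (lam B G) (pred a R z))
    have hF'' : IsFunOn F' B' := isFunOn_lam
    have hF' : ∀ z, z ∊ B' → ap F' z = H z (restr (lam B G) (pred a R z)) := fun z hz => ap_lam hz
    have hB' : ∀ z, z ∊ B' ↔ z ∊ B ∨ z = x := fun z => by simp only [B', mem_bun, mem_upair, or_self]
    have hsub' : ∀ z, z ∊ B' → IsSubset (pred a R z) B := by
      intro z hz
      rcases (hB' z).1 hz with hz | rfl
      · exact (hF.2.2 z hz).1
      · exact hsub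
    refine hxB ((hB x).2 ⟨hx, B', F', ⟨?_, isFunOn_lam, fun z hz => ⟨?_, ?_⟩⟩,
      (hB' x).2 (Or.inr rfl)⟩)
    · intro z hz
      rcases (hB' z).1 hz with hz | rfl
      · exact hF.1 z hz
      · exact hx
    · exact fun y hy => (hB' y).2 (Or.inl (hsub' z hz y hy))
    · rw [hF' z hz, restr_congr hF.2.1 hF'' (hsub' z hz)
        (fun y hy => (hB' y).2 (Or.inl (hsub' z hz y hy)))]
      intro y hy
      have hyB := hsub' z hz y hy
      rw [(hF.2.2 y hyB).2, hF' y ((hB' y).2 (Or.inl hyB))]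
  have hBa : B = a := ext fun x => ⟨fun hx => ((hB x).1 hx).1, hall x⟩
  rw [hBa] at hF
  exact ⟨lam a G, hF.2.1, fun x hx => (hF.2.2 x hx).2⟩

end Recursion

/-! ## Normal measures -/

section

variable {M : Set ZFSet.{u}} {C : Set M}

/-- Placed in the context, this acts as a local instance that closes definability of `P` under
substitution of terms. -/
theorem Def.inst₂ {P : M → M → Prop} (h : Def C (fun v => P (v 0) (v 1))) :
    ∀ (s t : (ℕ → M) → M) [DefT C s] [DefT C t], Def C (fun v => P (s v) (t v)) :=
  fun _ _ hs ht => h.subst₂ hs ht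

theorem DefT.inst₁ {G : M → M} (h : DefT C (fun v => G (v 0))) :
    ∀ (s : (ℕ → M) → M) [DefT C s], DefT C (fun v => G (s v)) :=
  fun _ hs => h.subst₁ hs

end

section Measure

variable {M : Set ZFSet.{u}} [hM : Fact (IsTransitiveModelZFC M)] {C : Set M}

/-- The set of `α ∊ κ` with `P α` belongs to `μ`. -/
def Large (κ μ : M) (P : M → Prop) : Prop := cls (fun α => α ∊ κ ∧ P α) ∊ μ

instance Def.large {s t : (ℕ → M) → M} {P : (ℕ → M) → M → Prop} [hs : DefT C s] [ht : DefT C t]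
    [h : Def C (fun v => P (fun n => v (n + 1)) (v 0))] :
    Def C (fun v => Large (s v) (t v) (P v)) := by
  have hs' := fun f => hs.shift f
  exact (inferInstance : Def C (fun v => cls (fun α => α ∊ s v ∧ P v α) ∊ t v))

variable {κ μ : M}

/-- The filter generated by the members of an ultrafilter in the sense of the model. -/
def IsUltrafilter.ae (h : IsUltrafilter κ μ) : Filter M where
  sets := {s | ∃ S, S ∊ μ ∧ ∀ α, α ∊ S → α ∈ s}
  univ_sets := ⟨κ, h.2.1, fun _ _ => trivial⟩
  sets_of_superset := fun ⟨S, hS, h⟩ hst => ⟨S, hS, fun α hα => hst (h α hα)⟩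
  inter_sets := fun ⟨S, hS, h1⟩ ⟨T, hT, h2⟩ =>
    ⟨inter S T, h.2.2.2.1 S T _ hS hT (mem_inter S T), fun α hα =>
      ⟨h1 α ((mem_inter _ _ _).1 hα).1, h2 α ((mem_inter _ _ _).1 hα).2⟩⟩

namespace IsUltrafilter

variable (h : IsUltrafilter κ μ)
include h

theorem eventually_iff {P : M → Prop} [hP : Def Set.univ (fun v : ℕ → M => P (v 0))] :
    (∀ᶠ α in h.ae, P α) ↔ Large κ μ P := by
  constructor
  · rintro ⟨S, hS, hSP⟩
    exact h.2.2.1 S _ hS (fun z hz => (mem_sep z).2 ⟨h.1 S hS z hz, hSP z hz⟩)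
      fun z hz => ((mem_sep z).1 hz).1
  · exact fun hL => ⟨_, hL, fun α hα => ((mem_sep α).1 hα).2⟩

theorem eventually_mem : ∀ᶠ α in h.ae, α ∊ κ := ⟨κ, h.2.1, fun _ hα => hα⟩

/-- The filter decides only sets of M, hence the definability hypothesis. -/
theorem eventually_not {P : M → Prop} [hP : Def Set.univ (fun v : ℕ → M => P (v 0))] :
    (∀ᶠ α in h.ae, ¬ P α) ↔ ¬ ∀ᶠ α in h.ae, P α := by
  rw [h.eventually_iff, h.eventually_iff, Large, Large,
    h.2.2.2.2 (cls fun α => α ∊ κ ∧ P α) (cls fun α => α ∊ κ ∧ ¬ P α)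
      (fun z hz => ((mem_sep z).1 hz).1), not_not]
  intro x
  rw [mem_sep, mem_sep]
  tauto

theorem neBot : h.ae.NeBot := by
  refine ⟨fun hb => ?_⟩
  have h1 : ∀ᶠ α in h.ae, ¬ True := by rw [hb]; trivial
  exact h.eventually_not.1 h1 (Filter.Eventually.of_forall fun _ => trivial)

theorem eventually_const {p : Prop} (hp : ∀ᶠ _ in h.ae, p) : p := by
  have := h.neBot
  exact hp.exists.choose_spec

end IsUltrafilter

/-! ### Almost-everywhere calculus for a normal measure. -/

namespace IsNormalMeasure

variable (h : IsNormalMeasure κ μ)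
include h

/-- The filter generated by a normal measure. -/
abbrev ae : Filter M := h.2.2.1.ae

theorem complete {γ : M} (hγ : γ ∊ κ) (P : M → M → Prop)
    [hP : Def Set.univ (fun v : ℕ → M => P (v 0) (v 1))]
    (hev : ∀ β, β ∊ γ → ∀ᶠ α in h.ae, P β α) : ∀ᶠ α in h.ae, ∀ β, β ∊ γ → P β α := by
  have := hP.inst₂
  rw [h.2.2.1.eventually_iff]
  refine h.2.2.2.2.1 γ (lam γ fun β => cls fun α => α ∊ κ ∧ P β α) _ hγ ⟨isFunOn_lam, ?_⟩ ?_
  · intro β y hy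
    obtain ⟨hβ, rfl⟩ := app_lam.1 hy
    exact h.2.2.1.eventually_iff.1 (hev β hβ)
  · intro α
    rw [mem_sep]
    refine and_congr_right fun hα => ⟨fun H β X hX => ?_, fun H β hβ => ?_⟩
    · obtain ⟨hβ, rfl⟩ := app_lam.1 hX
      exact (mem_sep α).2 ⟨hα, H β hβ⟩
    · exact ((mem_sep α).1 (H β _ (app_lam.2 ⟨hβ, rfl⟩))).2

theorem diagonal (P : M → M → Prop) [hP : Def Set.univ (fun v : ℕ → M => P (v 0) (v 1))]
    (hev : ∀ β, β ∊ κ → ∀ᶠ α in h.ae, P β α) : ∀ᶠ α in h.ae, ∀ β, β ∊ α → P β α := by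
  have := hP.inst₂
  rw [h.2.2.1.eventually_iff]
  refine h.2.2.2.2.2 (lam κ fun β => cls fun α => α ∊ κ ∧ P β α) _ ⟨isFunOn_lam, ?_⟩ ?_
  · intro β y hy
    obtain ⟨hβ, rfl⟩ := app_lam.1 hy
    exact h.2.2.1.eventually_iff.1 (hev β hβ)
  · intro α
    rw [mem_sep]
    refine and_congr_right fun hα => ⟨fun H β X hβα hX => ?_, fun H β hβ => ?_⟩
    · obtain ⟨hβ, rfl⟩ := app_lam.1 hX
      exact (mem_sep α).2 ⟨hα, H β hβα⟩
    · exact ((mem_sep α).1 (H β _ hβ (app_lam.2 ⟨h.1.mem_trans hα hβ, rfl⟩))).2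

theorem eventually_ne {ξ : M} (hξ : ξ ∊ κ) : ∀ᶠ α in h.ae, α ≠ ξ := by
  change ∀ᶠ α in h.ae, ¬ α = ξ
  rw [h.2.2.1.eventually_not, h.2.2.1.eventually_iff]
  refine h.2.2.2.1 ξ _ hξ fun α => ?_
  rw [mem_sep]
  constructor
  · exact fun h => Or.inl h.2
  · rintro (rfl | rfl) <;> exact ⟨hξ, rfl⟩

theorem eventually_gt {ξ : M} (hξ : ξ ∊ κ) : ∀ᶠ α in h.ae, ξ ∊ α := by
  have h1 := h.complete hξ (fun β α => α ≠ β) fun β hβ => h.eventually_ne (h.1.mem_trans hξ hβ)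
  filter_upwards [h1, h.eventually_ne hξ, h.2.2.1.eventually_mem] with α h1 h2 h3
  rcases (h.1.mem hξ).trichotomy (h.1.mem h3) with h4 | h4 | h4
  · exact h4
  · exact (h2 h4.symm).elim
  · exact (h1 α h4 rfl).elim

theorem eventually_inter_eq {ξ : M} (hξ : ξ ∊ κ) : ∀ᶠ α in h.ae, inter ξ α = ξ := by
  filter_upwards [h.eventually_gt hξ, h.2.2.1.eventually_mem] with α h1 h2
  exact ext fun z => by
    rw [mem_inter]; exact ⟨fun h => h.1, fun hz => ⟨hz, (h.1.mem h2).mem_trans h1 hz⟩⟩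

/-- If G avoided each ξ < κ almost everywhere, then by diagonal intersection almost every α would
have G(α) different from every ξ < α. -/
theorem regressive (G : M → M) [hG : DefT Set.univ (fun v : ℕ → M => G (v 0))]
    (hev : ∀ᶠ α in h.ae, G α ∊ α) : ∃ ξ, ξ ∊ κ ∧ ∀ᶠ α in h.ae, G α = ξ := by
  have := hG.inst₁
  by_contra hc
  have h1 := h.diagonal (fun ξ α => ¬ G α = ξ) fun ξ hξ =>
    h.2.2.1.eventually_not.2 fun hev => hc ⟨ξ, hξ, hev⟩
  refine h.2.2.1.eventually_const ?_
  filter_upwards [hev, h1] with α h2 h3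
  exact h3 _ h2 rfl

/-- Normality makes the identity represent κ, so a function with G(α) ⊆ α represents a subset of κ,
namely the set of ξ that lie in almost all G(α). -/
theorem capture (G : M → M) [hG : DefT Set.univ (fun v : ℕ → M => G (v 0))]
    (hev : ∀ᶠ α in h.ae, IsSubset (G α) α) :
    ∃ Y, IsSubset Y κ ∧ ∀ᶠ α in h.ae, G α = inter Y α := by
  have := hG.inst₁
  let Y := cls fun ξ => ξ ∊ κ ∧ Large κ μ (fun α => ξ ∊ G α)
  have hY : ∀ ξ, ξ ∊ Y ↔ ξ ∊ κ ∧ Large κ μ (fun α => ξ ∊ G α) := fun ξ => mem_sep ξ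
  refine ⟨Y, fun ξ hξ => ((hY ξ).1 hξ).1, ?_⟩
  have h1 := h.diagonal (fun ξ α => ξ ∊ G α ↔ ξ ∊ Y) (by
    intro ξ hξ
    by_cases hc : ξ ∊ Y
    · filter_upwards [h.2.2.1.eventually_iff.2 ((hY ξ).1 hc).2] with α hα
      exact iff_of_true hα hc
    · have : ¬ ∀ᶠ α in h.ae, ξ ∊ G α := by
        rw [h.2.2.1.eventually_iff]
        exact fun hL => hc ((hY ξ).2 ⟨hξ, hL⟩)
      filter_upwards [h.2.2.1.eventually_not.2 this] with α hα
      exact iff_of_false hα hc)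
  filter_upwards [hev, h1] with α h2 h3
  refine ext fun z => ?_
  rw [mem_inter]
  exact ⟨fun hz => ⟨(h3 z (h2 z hz)).1 hz, h2 z hz⟩, fun hz => (h3 z hz.2).2 hz.1⟩

theorem eventually_inter_inj {Y Z : M} (hY : IsSubset Y κ) (hZ : IsSubset Z κ)
    (hev : ∀ᶠ α in h.ae, inter Y α = inter Z α) : Y = Z := by
  have key : ∀ Y Z : M, IsSubset Y κ → (∀ᶠ α in h.ae, inter Y α = inter Z α) →
      ∀ z, z ∊ Y → z ∊ Z := by
    intro Y Z hY hev z hz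
    refine h.2.2.1.eventually_const ?_
    filter_upwards [hev, h.eventually_gt (hY z hz)] with α h1 h2
    exact ((mem_inter _ _ _).1 (h1 ▸ (mem_inter Y α z).2 ⟨hz, h2⟩)).1
  exact ext fun z => ⟨key Y Z hY hev z, key Z Y hZ (hev.mono fun _ h => h.symm) z⟩

theorem memMod_iff {f g : M} (hf : IsFunOn f κ) (hg : IsFunOn g κ) :
    MemMod κ μ f g ↔ ∀ᶠ α in h.ae, ap f α ∊ ap g α := by
  have key : ∀ α, α ∊ κ → ((∃ x y, App f α x ∧ App g α y ∧ x ∊ y) ↔ ap f α ∊ ap g α) := by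
    intro α hα
    simp only [hf.app_iff hα, hg.app_iff hα]
    exact ⟨fun ⟨x, y, hx, hy, hxy⟩ => hx ▸ hy ▸ hxy, fun hxy => ⟨_, _, rfl, rfl, hxy⟩⟩
  rw [h.2.2.1.eventually_iff]
  constructor
  · rintro ⟨S, hS, hSα⟩
    have : S = cls fun α => α ∊ κ ∧ ap f α ∊ ap g α := ext fun α => by
      rw [mem_sep, hSα]; exact and_congr_right (key α)
    rwa [Large, ← this]
  · intro hL
    refine ⟨_, hL, fun α => ?_⟩
    rw [mem_sep]
    exact and_congr_right fun hα => (key α hα).symm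

theorem eqMod_iff {f g : M} (hf : IsFunOn f κ) (hg : IsFunOn g κ) :
    EqMod κ μ f g ↔ ∀ᶠ α in h.ae, ap f α = ap g α := by
  have key : ∀ α, α ∊ κ → ((∃ x, App f α x ∧ App g α x) ↔ ap f α = ap g α) := by
    intro α hα
    simp only [hf.app_iff hα, hg.app_iff hα]
    exact ⟨fun ⟨x, hx, hy⟩ => hx ▸ hy, fun hxy => ⟨_, rfl, hxy⟩⟩
  rw [h.2.2.1.eventually_iff]
  constructor
  · rintro ⟨S, hS, hSα⟩
    have : S = cls fun α => α ∊ κ ∧ ap f α = ap g α := ext fun α => by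
      rw [mem_sep, hSα]; exact and_congr_right (key α)
    rwa [Large, ← this]
  · intro hL
    refine ⟨_, hL, fun α => ?_⟩
    rw [mem_sep]
    exact and_congr_right fun hα => (key α hα).symm

end IsNormalMeasure

/-! ### Sets of subsets of `κ` in the ultrapower -/

/-- `X` agrees on the subsets of `κ` with the element of the ultrapower represented by `g`. -/
def Represents (κ μ g X : M) : Prop :=
  ∀ Y, IsSubset Y κ → (Y ∊ X ↔ Large κ μ fun α => inter Y α ∊ ap g α)

/-- `X` agrees on the subsets of `κ` with an element of the ultrapower. -/
def Rep (κ μ X : M) : Prop := ∃ g, Represents κ μ g X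

instance Def.represents {q r s t : (ℕ → M) → M} [hq : DefT C q] [hr : DefT C r] [hs : DefT C s]
    [ht : DefT C t] : Def C (fun v => Represents (q v) (r v) (s v) (t v)) := by
  have hq' := fun f => hq.shift f
  have hr' := fun f => hr.shift f
  have hs' := fun f => hs.shift f
  have ht' := fun f => ht.shift f
  unfold Represents
  infer_instance

instance Def.rep {r s t : (ℕ → M) → M} [hr : DefT C r] [hs : DefT C s] [ht : DefT C t] :
    Def C (fun v => Rep (r v) (s v) (t v)) :=
  Def.subst₃ (by unfold Rep; infer_instance) hr hs ht

theorem IsNormalMeasure.represents_iff (h : IsNormalMeasure κ μ) {g X : M} :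
    Represents κ μ g X ↔
      ∀ Y, IsSubset Y κ → (Y ∊ X ↔ ∀ᶠ α in h.ae, inter Y α ∊ ap g α) := by
  simp only [Represents, h.2.2.1.eventually_iff]

/-- The function `f` collapsing to X is itself the representing function, once it is known that the
class of α ↦ Y ∩ α is what collapses to Y, for each Y ⊆ κ. -/
theorem IsNormalMeasure.rep_of_inUlt (h : IsNormalMeasure κ μ) {X : M} (hU : InUlt κ μ X) : Rep κ μ X := by
  obtain ⟨T, c, f, ⟨hT, hT', hc, hcol⟩, hf⟩ := hU
  have hcT : ∀ {g y}, App c g y → g ∊ T := fun hg => (hc.app_iff'.1 hg).1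
  have hmem : ∀ {g y}, App c g y → ∀ z, z ∊ y ↔ ∃ k, k ∊ T ∧
      (∀ᶠ α in h.ae, ap k α ∊ ap g α) ∧ App c k z := by
    intro g y hg z
    rw [hcol g y hg z]
    refine exists_congr fun k => and_congr_right fun hk => ?_
    rw [h.memMod_iff (hT k hk) (hT g (hcT hg))]
  have hrep : ∀ {g k}, g ∊ T → IsFunOn k κ → (∀ᶠ α in h.ae, ap k α ∊ ap g α) →
      ∃ k', k' ∊ T ∧ ∀ᶠ α in h.ae, ap k' α = ap k α := by
    intro g k hg hk hkg
    obtain ⟨k', hk', he⟩ := hT' g k hg hk ((h.memMod_iff hk (hT g hg)).2 hkg)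
    exact ⟨k', hk', (h.eqMod_iff (hT k' hk') hk).1 he⟩
  -- Induction on Y: members of Y are ordinals ξ < κ, again subsets of κ, and ξ ∩ α = ξ for almost
  -- all α, so the induction hypothesis covers constant functions.
  have key : ∀ Y, IsSubset Y κ → ∀ g, g ∊ T →
      ((∀ᶠ α in h.ae, ap g α = inter Y α) ↔ App c g Y) := by
    intro Y
    induction Y using mem_wf.induction with
    | _ Y ih =>
    intro hY g hg
    have ih' : ∀ ξ, ξ ∊ Y → ∀ k, k ∊ T → ((∀ᶠ α in h.ae, ap k α = ξ) ↔ App c k ξ) := by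
      intro ξ hξ k hk
      rw [← ih ξ hξ (h.1.1 ξ (hY ξ hξ)) k hk]
      refine Filter.eventually_congr ?_
      filter_upwards [h.eventually_inter_eq (hY ξ hξ)] with α hα
      rw [hα]
    constructor
    · intro hgY
      obtain ⟨y, hy, -⟩ := hc.2 g hg
      suffices y = Y from this ▸ hy
      refine ext fun z => ?_
      rw [hmem hy z]
      constructor
      · rintro ⟨k, hk, hkg, hkz⟩
        obtain ⟨ξ, hξ, hev⟩ := h.regressive (fun α => ap k α) (by
          filter_upwards [hkg, hgY] with α h1 h2
          rw [h2, mem_inter] at h1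
          exact h1.2)
        have hξY : ξ ∊ Y := by
          refine h.2.2.1.eventually_const ?_
          filter_upwards [hkg, hgY, hev] with α h1 h2 h3
          rw [h2, mem_inter, h3] at h1
          exact h1.1
        have := (ih' ξ hξY k hk).1 hev
        rw [hc.app_iff hk] at this hkz
        rwa [hkz, ← this]
      · intro hz
        have hzg : ∀ᶠ α in h.ae, ap (lam κ fun _ => z) α ∊ ap g α := by
          filter_upwards [hgY, h.eventually_gt (hY z hz), h.2.2.1.eventually_mem] with α h1 h2 h3
          rw [h1, ap_lam h3, mem_inter]
          exact ⟨hz, h2⟩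
        obtain ⟨k, hk, hkev⟩ := hrep hg isFunOn_lam hzg
        refine ⟨k, hk, ?_, (ih' z hz k hk).1 ?_⟩
        · filter_upwards [hzg, hkev] with α h1 h2
          rwa [h2]
        · filter_upwards [hkev, h.2.2.1.eventually_mem] with α h1 h2
          rw [h1, ap_lam h2]
    · intro hgY
      have h1 := h.diagonal (fun ξ α => ξ ∊ Y → ξ ∊ ap g α) (by
        intro ξ _
        by_cases hξY : ξ ∊ Y
        · obtain ⟨k, hk, hkg, hkξ⟩ := (hmem hgY ξ).1 hξY
          filter_upwards [hkg, (ih' ξ hξY k hk).2 hkξ] with α h1 h2 _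
          rwa [← h2]
        · exact Filter.Eventually.of_forall fun α hc => (hξY hc).elim)
      -- Otherwise choose k(α) in g(α) outside Y ∩ α; then k collapses to some z ∈ Y, so k is almost
      -- everywhere the constant z, which does lie in Y ∩ α.
      have h2 : ∀ᶠ α in h.ae, IsSubset (ap g α) (inter Y α) := by
        by_contra hcon
        rw [← h.2.2.1.eventually_not] at hcon
        obtain ⟨k, hk, hkQ⟩ := exists_choice_fun (fun α x => x ∊ ap g α ∧ ¬ x ∊ inter Y α)
          κ (sUnion (image κ fun α => ap g α))
        have hkev : ∀ᶠ α in h.ae, ap k α ∊ ap g α ∧ ¬ ap k α ∊ inter Y α := by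
          filter_upwards [hcon, h.2.2.1.eventually_mem] with α h1 h2
          refine (hkQ α h2 ?_).2
          simp only [IsSubset, not_forall] at h1
          obtain ⟨x, hx, hx'⟩ := h1
          exact ⟨x, (mem_sUnion _ _).2 ⟨_, (mem_image _).2 ⟨α, h2, rfl⟩, hx⟩, hx, hx'⟩
        obtain ⟨k', hk', hkk⟩ := hrep hg hk (hkev.mono fun _ h => h.1)
        obtain ⟨z, hz, -⟩ := hc.2 k' hk'
        have hzY : z ∊ Y := (hmem hgY z).2 ⟨k', hk', by
          filter_upwards [hkev, hkk] with α h1 h2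
          rw [h2]
          exact h1.1, hz⟩
        refine h.2.2.1.eventually_const ?_
        filter_upwards [hkev, hkk, (ih' z hzY k' hk').2 hz, h.eventually_gt (hY z hzY)]
          with α h1 h2 h3 h4
        rw [← h2, h3, mem_inter] at h1
        exact h1.2 ⟨hzY, h4⟩
      filter_upwards [h1, h2] with α h1 h2
      refine IsSubset.antisymm h2 fun z hz => ?_
      rw [mem_inter] at hz
      exact h1 z hz.2 hz.1
  refine ⟨f, h.represents_iff.2 fun Y hY => ?_⟩
  rw [hmem hf Y]
  constructor
  · rintro ⟨k, hk, hkf, hkY⟩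
    filter_upwards [hkf, (key Y hY k hk).2 hkY] with α h1 h2
    rwa [← h2]
  · intro hev
    have hev' : ∀ᶠ α in h.ae, ap (lam κ fun α => inter Y α) α ∊ ap f α := by
      filter_upwards [hev, h.2.2.1.eventually_mem] with α h1 h2
      rwa [ap_lam h2]
    obtain ⟨k, hk, hkev⟩ := hrep (hcT hf) isFunOn_lam hev'
    refine ⟨k, hk, ?_, (key Y hY k hk).1 ?_⟩
    · filter_upwards [hkev, hev'] with α h1 h2
      rwa [h1]
    · filter_upwards [hkev, h.2.2.1.eventually_mem] with α h1 h2
      rw [h1, ap_lam h2]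

/-- The collapse is written down explicitly on the set of functions f with f(α) ⊆ P(α), as f ↦ {Y ⊆
κ : Y ∩ α ∈ f(α) almost everywhere}. By `capture`, members of such f are equivalent to functions α ↦
Y ∩ α, which again lie in this set. -/
theorem IsNormalMeasure.inUlt_of_rep (h : IsNormalMeasure κ μ) {X : M}
    (hX : ∀ Y, Y ∊ X → IsSubset Y κ) (hR : Rep κ μ X) : InUlt κ μ X := by
  obtain ⟨g, hg⟩ := hR
  rw [h.represents_iff] at hg
  let good : M → Prop := fun f => IsFunOn f κ ∧ ∀ α, α ∊ κ → ∀ z, z ∊ ap f α → IsSubset z α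
  have instGood : ∀ (s : (ℕ → M) → M) [DefT Set.univ s], Def Set.univ (fun v => good (s v)) :=
    fun s hs => Def.subst₁ (by simp only [good]; infer_instance) hs
  let T := cls good
  have hT : ∀ f, f ∊ T ↔ good f := by
    refine mem_cls (pow (prod κ (pow (pow κ)))) fun f hf => ?_
    rw [mem_pow]
    intro p hp
    obtain ⟨α, y, hα, hp'⟩ := hf.1.1 p hp
    rw [isOPair_iff] at hp'
    subst hp'
    rw [op_mem_prod, mem_pow]
    refine ⟨hα, fun z hz => (mem_pow _ _).2 fun w hw => ?_⟩
    rw [(hf.1.app_iff hα).1 (app_iff.2 hp)] at hz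
    exact h.1.mem_trans hα (hf.2 α hα z hz w hw)
  let c₀ : M → M := fun f => cls fun Y => IsSubset Y κ ∧ Large κ μ fun α => inter Y α ∊ ap f α
  have instc : ∀ (s : (ℕ → M) → M) [DefT Set.univ s], DefT Set.univ (fun v => c₀ (s v)) :=
    fun s hs => DefT.subst₁ (by simp only [c₀]; infer_instance) hs
  have hc₀ : ∀ f Y, Y ∊ c₀ f ↔ IsSubset Y κ ∧ ∀ᶠ α in h.ae, inter Y α ∊ ap f α := fun f Y => by
    rw [h.2.2.1.eventually_iff]
    exact mem_cls (pow κ) (fun Y hY => (mem_pow _ _).2 hY.1) Y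
  have hcongr : ∀ f f', (∀ᶠ α in h.ae, ap f α = ap f' α) → c₀ f = c₀ f' := by
    intro f f' hff
    refine ext fun Y => ?_
    rw [hc₀, hc₀]
    refine and_congr_right fun _ => Filter.eventually_congr ?_
    filter_upwards [hff] with α h1
    rw [h1]
  let r : M → M := fun Y => lam κ fun α => inter Y α
  have hr : ∀ Y, ∀ᶠ α in h.ae, ap (r Y) α = inter Y α := fun Y => by
    filter_upwards [h.2.2.1.eventually_mem] with α h1
    exact ap_lam h1
  have hrT : ∀ Y, r Y ∊ T := by
    intro Y
    refine (hT _).2 ⟨isFunOn_lam, fun α hα z hz => ?_⟩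
    rw [show ap (r Y) α = inter Y α from ap_lam hα, mem_inter] at hz
    exact (h.1.mem hα).1 z hz.2
  have hcr : ∀ Y, IsSubset Y κ → c₀ (r Y) = Y := by
    intro Y hY
    refine ext fun Z => ?_
    rw [hc₀]
    constructor
    · rintro ⟨hZ, hev⟩
      have hev' : ∀ᶠ α in h.ae, inter Z α ∊ inter Y α := by
        filter_upwards [hev, hr Y] with α h1 h2
        rwa [← h2]
      obtain ⟨ξ, hξ, hξev⟩ := h.regressive (fun α => inter Z α)
        (hev'.mono fun α h1 => ((mem_inter _ _ _).1 h1).2)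
      have : Z = ξ := h.eventually_inter_inj hZ (h.1.1 ξ hξ) (by
        filter_upwards [hξev, h.eventually_inter_eq hξ] with α h1 h2
        rw [h1, h2])
      subst this
      refine h.2.2.1.eventually_const ?_
      filter_upwards [hev', hξev] with α h1 h2
      rw [h2, mem_inter] at h1
      exact h1.1
    · intro hZ
      refine ⟨h.1.1 Z (hY Z hZ), ?_⟩
      filter_upwards [hr Y, h.eventually_inter_eq (hY Z hZ), h.eventually_gt (hY Z hZ)]
        with α h1 h2 h3
      rw [h1, h2, mem_inter]
      exact ⟨hZ, h3⟩
  have hrep : ∀ f k, f ∊ T → (∀ᶠ α in h.ae, ap k α ∊ ap f α) →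
      ∃ Y, IsSubset Y κ ∧ ∀ᶠ α in h.ae, ap k α = inter Y α := by
    intro f k hf hk
    refine h.capture (fun α => ap k α) ?_
    filter_upwards [hk, h.2.2.1.eventually_mem] with α h1 h2
    exact ((hT f).1 hf).2 α h2 _ h1
  have hfun : ∀ f, f ∊ T → IsFunOn f κ := fun f hf => ((hT f).1 hf).1
  -- Cutting g(α) down to P(α) puts the function in `T` and does not affect the test Y ∩ α ∈ g(α).
  let f₀ := lam κ fun α => inter (ap g α) (pow α)
  have hf₀ : f₀ ∊ T := by
    refine (hT _).2 ⟨isFunOn_lam, fun α hα z hz => ?_⟩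
    rw [show ap f₀ α = _ from ap_lam hα, mem_inter, mem_pow] at hz
    exact hz.2
  refine ⟨T, lam T c₀, f₀, ⟨hfun, ?_, isFunOn_lam, ?_⟩, app_lam.2 ⟨hf₀, ?_⟩⟩
  · intro f k hf hk hkf
    rw [h.memMod_iff hk (hfun f hf)] at hkf
    obtain ⟨Y, -, hY⟩ := hrep f k hf hkf
    refine ⟨r Y, hrT Y, (h.eqMod_iff (hfun _ (hrT Y)) hk).2 ?_⟩
    filter_upwards [hY, hr Y] with α h1 h2
    rw [h1, h2]
  · intro f y hfy Z
    obtain ⟨hf, rfl⟩ := app_lam.1 hfy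
    constructor
    · intro hZ
      rw [hc₀] at hZ
      refine ⟨r Z, hrT Z, (h.memMod_iff (hfun _ (hrT Z)) (hfun f hf)).2 ?_,
        app_lam.2 ⟨hrT Z, (hcr Z hZ.1).symm⟩⟩
      filter_upwards [hZ.2, hr Z] with α h1 h2
      rwa [h2]
    · rintro ⟨k, hk, hkf, hkZ⟩
      rw [h.memMod_iff (hfun k hk) (hfun f hf)] at hkf
      obtain ⟨-, rfl⟩ := app_lam.1 hkZ
      obtain ⟨Y, hY, hkY⟩ := hrep f k hf hkf
      have : c₀ k = Y := by
        rw [← hcr Y hY]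
        refine hcongr _ _ ?_
        filter_upwards [hkY, hr Y] with α h1 h2
        rw [h1, h2]
      rw [this, hc₀]
      refine ⟨hY, ?_⟩
      filter_upwards [hkf, hkY] with α h1 h2
      rwa [← h2]
  · refine ext fun Y => ?_
    rw [hc₀]
    have key : (∀ᶠ α in h.ae, inter Y α ∊ ap f₀ α) ↔ ∀ᶠ α in h.ae, inter Y α ∊ ap g α := by
      refine Filter.eventually_congr ?_
      filter_upwards [h.2.2.1.eventually_mem] with α h1
      rw [show ap f₀ α = _ from ap_lam h1, mem_inter, mem_pow]
      exact and_iff_left fun z hz => ((mem_inter _ _ _).1 hz).2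
    rw [key]
    exact ⟨fun hY => ⟨hX Y hY, (hg Y (hX Y hY)).1 hY⟩, fun hY => (hg Y hY.1).2 hY.2⟩

theorem IsNormalMeasure.inUlt_iff (h : IsNormalMeasure κ μ) {X : M}
    (hX : ∀ Y, Y ∊ X → IsSubset Y κ) : InUlt κ μ X ↔ Rep κ μ X :=
  ⟨h.rep_of_inUlt, h.inUlt_of_rep hX⟩

end Measure

/-! ## Well-foundedness of the Mitchell order -/

section Mitchell

variable {M : Set ZFSet.{u}} [hM : Fact (IsTransitiveModelZFC M)] {κ μ ν X : M}

/-- Bounding the representing functions by a fixed set makes it possible to choose among them. -/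
theorem IsNormalMeasure.exists_represents (h : IsNormalMeasure κ μ) (hR : Rep κ μ X) :
    ∃ g, g ∊ pow (prod κ (pow (pow κ))) ∧ Represents κ μ g X := by
  obtain ⟨g, hg⟩ := hR
  rw [h.represents_iff] at hg
  refine ⟨lam κ fun α => inter (ap g α) (pow α), ?_, h.represents_iff.2 fun Y hY => ?_⟩
  · rw [mem_pow]
    intro p hp
    obtain ⟨α, hα, rfl⟩ := (mem_lam p).1 hp
    rw [op_mem_prod, mem_pow]
    refine ⟨hα, fun z hz => ?_⟩
    rw [mem_inter, mem_pow] at hz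
    exact (mem_pow _ _).2 fun w hw => h.1.mem_trans hα (hz.2 w hw)
  · rw [hg Y hY]
    refine Filter.eventually_congr ?_
    filter_upwards [h.2.2.1.eventually_mem] with α h1
    rw [ap_lam h1, mem_inter, mem_pow]
    exact (and_iff_left fun z hz => ((mem_inter _ _ _).1 hz).2).symm

/-- With f representing ν and g representing X, one has Y ∈ X iff {ξ < κ : Y ∩ ξ ∈ g(ξ)} ∈ ν iff {ξ
< α : Y ∩ ξ ∈ g(ξ)} ∈ f(α) for almost all α. The last condition depends only on Y ∩ α. -/
theorem IsNormalMeasure.rep_trans (h : IsNormalMeasure κ μ) (hν : Rep κ μ ν)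
    (hX : Rep κ ν X) : Rep κ μ X := by
  obtain ⟨f, hf⟩ := hν
  obtain ⟨g, hg⟩ := hX
  rw [h.represents_iff] at hf
  refine ⟨lam κ fun α => cls fun Z => Z ∊ pow α ∧ cls (fun ξ => ξ ∊ α ∧ inter Z ξ ∊ ap g ξ) ∊ ap f α,
    h.represents_iff.2 fun Y hY => ?_⟩
  rw [hg Y hY, Large, hf _ fun z hz => ((mem_sep z).1 hz).1]
  refine Filter.eventually_congr ?_
  filter_upwards [h.2.2.1.eventually_mem] with α hα
  have heq : inter (cls fun ξ => ξ ∊ κ ∧ inter Y ξ ∊ ap g ξ) α =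
      cls fun ξ => ξ ∊ α ∧ inter (inter Y α) ξ ∊ ap g ξ := by
    refine ext fun ξ => ?_
    rw [mem_inter, mem_sep, mem_sep]
    have key : ξ ∊ α → inter (inter Y α) ξ = inter Y ξ := fun hξ => ext fun z => by
      rw [mem_inter, mem_inter, mem_inter]
      exact ⟨fun hz => ⟨hz.1.1, hz.2⟩,
        fun hz => ⟨⟨hz.1, (h.1.mem hα).mem_trans hξ hz.2⟩, hz.2⟩⟩
    constructor
    · rintro ⟨⟨-, h1⟩, h2⟩
      exact ⟨h2, (key h2).symm ▸ h1⟩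
    · rintro ⟨h1, h2⟩
      exact ⟨⟨h.1.mem_trans hα h1, key h1 ▸ h2⟩, h1⟩
  rw [ap_lam hα, mem_sep, heq, mem_pow]
  exact (and_iff_right fun z hz => ((mem_inter _ _ _).1 hz).2).symm

theorem suc_inj {x y : M} (h : suc x = suc y) : x = y := by
  have h1 := (mem_suc y x).1 (h ▸ (mem_suc x x).2 (Or.inr rfl))
  have h2 := (mem_suc x y).1 (h ▸ (mem_suc y y).2 (Or.inr rfl))
  rcases h1 with h1 | h1
  · rcases h2 with h2 | h2
    · exact (mem_asymm h1 h2).elim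
    · exact h2.symm
  · exact h1

theorem IsOrd.suc {x : M} (h : IsOrd x) : IsOrd (suc x) := by
  refine isOrd_of (fun y hy z hz => ?_) fun y hy => ?_
  · rw [mem_suc] at hy ⊢
    rcases hy with hy | rfl
    · exact Or.inl (h.mem_trans hy hz)
    · exact Or.inl hz
  · rcases (mem_suc _ _).1 hy with hy | rfl
    · exact h.mem hy
    · exact h

theorem IsOrd.suc_mem_of_limit {w z : M} (hw : IsOrd w) (hlim : ∀ z, z ∊ w → ∃ y, y ∊ w ∧ z ∊ y)
    (hz : z ∊ w) : SetModel.suc z ∊ w := by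
  obtain ⟨y, hy, hzy⟩ := hlim z hz
  rcases (hw.mem hz).suc.mem_or_subset hw with h | h
  · exact h
  · rcases (mem_suc _ _).1 (h y hy) with h' | rfl
    · exact (mem_asymm h' hzy).elim
    · exact (mem_irrefl _ hzy).elim

theorem IsFunOn.ap_restr {f a s x : M} (hf : IsFunOn f a) (hs : IsSubset s a) (hx : x ∊ s) :
    ap (SetModel.restr f s) x = ap f x :=
  (((hf.restr hs).app_iff hx).1 ((hf.app_restr hs).2 ⟨hx, rfl⟩)).symm

theorem mem_pred_mem {κ α β : M} : β ∊ pred κ (fun x y => x ∊ y) α ↔ β ∊ κ ∧ β ∊ α := mem_sep β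

/-- Iteration of the function `e` along a limit ordinal. -/
theorem exists_iterate {w S e x₀ : M} (hw : IsOrd w) (hne : ∃ z, z ∊ w)
    (hlim : ∀ z, z ∊ w → ∃ y, y ∊ w ∧ z ∊ y) (hx₀ : x₀ ∊ S) (he : ∀ x, x ∊ S → ap e x ∊ S) :
    ∃ f : M, (∃ x, x ∊ w ∧ ap f x ∊ S) ∧ (∀ x, x ∊ w → ap f x ∊ S) ∧
      ∀ x, x ∊ w → ∃ y, y ∊ w ∧ ap f y = ap e (ap f x) := by
  -- Nonsuccessor stages restart at `x₀`; only staying in `S` and the successor step matter.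
  obtain ⟨f, hf, hrec⟩ := exists_rec w (fun x y => x ∊ y) (fun x g => the fun y =>
    (∃ z, x = suc z ∧ y = ap e (ap g z)) ∨ ((¬ ∃ z, x = suc z) ∧ y = x₀)) (wfOn_mem w)
  have hsuc : ∀ z, z ∊ w → suc z ∊ w → ap f (suc z) = ap e (ap f z) := by
    intro z hz hz'
    rw [hrec _ hz', ← hf.ap_restr (s := pred w (fun x y => x ∊ y) (suc z))
      (fun y hy => (mem_pred_mem.1 hy).1) (mem_pred_mem.2 ⟨hz, (mem_suc _ _).2 (Or.inr rfl)⟩)]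
    refine the_eq (Or.inl ⟨z, rfl, rfl⟩) ?_
    rintro y (⟨z', hz', rfl⟩ | ⟨h, -⟩)
    · rw [suc_inj hz']
    · exact (h ⟨z, rfl⟩).elim
  have hS : ∀ x, x ∊ w → ap f x ∊ S := by
    intro x
    induction x using mem_wf.induction with
    | _ x ih =>
    intro hx
    by_cases hxs : ∃ z, x = suc z
    · obtain ⟨z, rfl⟩ := hxs
      have hz : z ∊ suc z := (mem_suc _ _).2 (Or.inr rfl)
      have hzw := hw.mem_trans hx hz
      rw [hsuc z hzw hx]
      exact he _ (ih z hz hzw)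
    · have : ap f x = x₀ := by
        rw [hrec x hx]
        refine the_eq (Or.inr ⟨hxs, rfl⟩) ?_
        rintro y (⟨z, hz, -⟩ | ⟨-, h⟩)
        · exact (hxs ⟨z, hz⟩).elim
        · exact h
      rw [this]
      exact hx₀
  refine ⟨f, ?_, hS, fun x hx => ⟨suc x, hw.suc_mem_of_limit hlim hx,
    hsuc x hx (hw.suc_mem_of_limit hlim hx)⟩⟩
  obtain ⟨z, hz⟩ := hne
  exact ⟨z, hz, hS z hz⟩

/-- The Mitchell order is well-founded. -/
theorem wfOn_rep {D : M} (hD : ∀ μ, μ ∊ D → IsNormalMeasure κ μ) :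
    WFOn D (fun ν μ => Rep κ μ ν) := by
  rintro S hSD ⟨x₀, hx₀⟩
  by_contra hcon
  push Not at hcon
  have hSn : ∀ ν, ν ∊ S → IsNormalMeasure κ ν := fun ν hν => hD ν (hSD ν hν)
  have hκ := (hSn x₀ hx₀).1
  -- The limit ordinal below κ supplied by the definition of normal measure plays the role of ω as
  -- index set of a descending sequence.
  obtain ⟨w, hwκ, hwne, hwlim⟩ := (hSn x₀ hx₀).2.1
  obtain ⟨e, -, he⟩ := exists_choice_fun (fun μ ν => Rep κ μ ν) S S
  have he' : ∀ x, x ∊ S → ap e x ∊ S ∧ Rep κ x (ap e x) := fun x hx => he x hx (hcon x hx)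
  obtain ⟨F, ⟨x₁, hx₁, -⟩, hFS, hFe⟩ := exists_iterate (hκ.mem hwκ) hwne hwlim hx₀
    fun x hx => (he' x hx).1
  let O := image w fun x => ap F x
  have hO : ∀ ν, ν ∊ O ↔ ∃ x, x ∊ w ∧ ν = ap F x := fun ν => mem_image ν
  have hOS : ∀ ν, ν ∊ O → ν ∊ S := by
    intro ν hν
    obtain ⟨x, hx, rfl⟩ := (hO ν).1 hν
    exact hFS x hx
  have hOe : ∀ ν, ν ∊ O → ∃ ν', ν' ∊ O ∧ Rep κ ν ν' := by
    intro ν hν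
    obtain ⟨x, hx, rfl⟩ := (hO ν).1 hν
    obtain ⟨y, hy, hyx⟩ := hFe x hx
    exact ⟨ap F y, (hO _).2 ⟨y, hy, rfl⟩, hyx ▸ (he' _ (hFS x hx)).2⟩
  have instQ : Def Set.univ (fun v : ℕ → M => ∃ ν ν', v 0 = op ν ν' ∧ Represents κ ν (v 1) ν') :=
    inferInstance
  obtain ⟨G, -, hG⟩ := exists_choice_fun (fun p g => ∃ ν ν', p = op ν ν' ∧ Represents κ ν g ν')
    (prod O O) (pow (prod κ (pow (pow κ))))
  have hG' : ∀ ν ν', ν ∊ O → ν' ∊ O → Rep κ ν ν' → Represents κ ν (ap G (op ν ν')) ν' := by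
    intro ν ν' hν hν' hR
    obtain ⟨g, hg, hgR⟩ := (hSn ν (hOS ν hν)).exists_represents hR
    obtain ⟨-, ν₁, ν₂, h12, h⟩ := hG (op ν ν') (op_mem_prod.2 ⟨hν, hν'⟩) ⟨g, hg, ν, ν', rfl, hgR⟩
    obtain ⟨rfl, rfl⟩ := op_inj.1 h12
    exact h
  -- Simultaneous recursion on α for sets Z_ν ⊆ κ, ν ∈ O: α enters Z_ν iff Z_ν' ∩ α ∉ G(ν, ν')(α)
  -- for every ν' ∈ O below ν, where G(ν, ν') represents ν' in the ultrapower by ν.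
  obtain ⟨Y, hY, hYrec⟩ := exists_rec κ (fun x y => x ∊ y) (fun α g => cls fun ν => ν ∊ O ∧
    ∀ ν', ν' ∊ O → Rep κ ν ν' →
      ¬ cls (fun β => β ∊ α ∧ ν' ∊ ap g β) ∊ ap (ap G (op ν ν')) α) (wfOn_mem κ)
  let Z : M → M := fun ν => cls fun α => α ∊ κ ∧ ν ∊ ap Y α
  have hYmem : ∀ α ν, α ∊ κ → (ν ∊ ap Y α ↔ ν ∊ O ∧ ∀ ν', ν' ∊ O → Rep κ ν ν' →
      ¬ inter (Z ν') α ∊ ap (ap G (op ν ν')) α) := by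
    intro α ν hα
    have hsub : IsSubset (pred κ (fun x y => x ∊ y) α) κ := fun y hy => (mem_pred_mem.1 hy).1
    have heq : ∀ ν', cls (fun β => β ∊ α ∧ ν' ∊ ap (restr Y (pred κ (fun x y => x ∊ y) α)) β) =
        inter (Z ν') α := by
      intro ν'
      refine ext fun β => ?_
      simp only [Z]
      rw [mem_sep, mem_inter, mem_sep]
      constructor
      · rintro ⟨hβ, h⟩
        have hβκ := hκ.mem_trans hα hβ
        rw [hY.ap_restr hsub (mem_pred_mem.2 ⟨hβκ, hβ⟩)] at h
        exact ⟨⟨hβκ, h⟩, hβ⟩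
      · rintro ⟨⟨hβκ, h⟩, hβ⟩
        rw [hY.ap_restr hsub (mem_pred_mem.2 ⟨hβκ, hβ⟩)]
        exact ⟨hβ, h⟩
    rw [hYrec α hα, mem_sep]
    simp only [heq]
  have hZκ : ∀ ν, IsSubset (Z ν) κ := fun ν z hz => ((mem_sep z).1 hz).1
  -- The Yablo condition: Z_ν is in ν exactly when Z_ν' is not in ν' for every ν' ∈ O below ν.
  have key : ∀ ν, ν ∊ O → (Z ν ∊ ν ↔ ∀ ν', ν' ∊ O → Rep κ ν ν' → ¬ Z ν' ∊ ν') := by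
    intro ν hν
    have h := hSn ν (hOS ν hν)
    have hev : ∀ ν', ν' ∊ O → Rep κ ν ν' →
        (Z ν' ∊ ν' ↔ ∀ᶠ α in h.ae, inter (Z ν') α ∊ ap (ap G (op ν ν')) α) :=
      fun ν' hν' hR => h.represents_iff.1 (hG' ν ν' hν hν' hR) (Z ν') (hZκ ν')
    have hL : Z ν ∊ ν ↔ ∀ᶠ α in h.ae, ν ∊ ap Y α := h.2.2.1.eventually_iff.symm
    rw [hL]
    constructor
    · intro hev' ν' hν' hR
      rw [hev ν' hν' hR, ← h.2.2.1.eventually_not]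
      filter_upwards [hev', h.2.2.1.eventually_mem] with α h1 h2
      exact ((hYmem α ν h2).1 h1).2 ν' hν' hR
    · intro hall
      have instZ : ∀ (s : (ℕ → M) → M) [DefT Set.univ s], DefT Set.univ (fun v => Z (s v)) :=
        fun s hs => DefT.subst₁ (by simp only [Z]; infer_instance) hs
      -- O is indexed by w < κ, so κ-completeness treats all ν' at once.
      have := h.complete hwκ (fun x α => Rep κ ν (ap F x) →
        ¬ inter (Z (ap F x)) α ∊ ap (ap G (op ν (ap F x))) α) (by
        intro x hx
        by_cases hR : Rep κ ν (ap F x)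
        · have hxO := (hO _).2 ⟨x, hx, rfl⟩
          have h1 := hall _ hxO hR
          rw [hev _ hxO hR, ← h.2.2.1.eventually_not] at h1
          exact h1.mono fun α h _ => h
        · exact Filter.Eventually.of_forall fun α hc => (hR hc).elim)
      filter_upwards [this, h.2.2.1.eventually_mem] with α h1 h2
      refine (hYmem α ν h2).2 ⟨hν, fun ν' hν' hR => ?_⟩
      obtain ⟨x, hx, rfl⟩ := (hO ν').1 hν'
      exact h1 x hx hR
  -- If Z_ν ∈ ν, some ν' below ν has Z_ν' ∉ ν', hence some ν'' below ν' has Z_ν'' ∈ ν''; by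
  -- transitivity ν'' is below ν, a contradiction. But if every Z_ν is outside its ν, the condition
  -- puts each of them inside.
  have hnot : ∀ ν, ν ∊ O → ¬ Z ν ∊ ν := by
    intro ν hν hZ
    obtain ⟨ν', hν', hR⟩ := hOe ν hν
    have hZ' := (key ν hν).1 hZ ν' hν' hR
    rw [key ν' hν'] at hZ'
    push Not at hZ'
    obtain ⟨ν'', hν'', hR', hZ''⟩ := hZ'
    exact (key ν hν).1 hZ ν'' hν''
      ((hSn ν (hOS ν hν)).rep_trans hR hR') hZ''
  have h1 : ap F x₁ ∊ O := (hO _).2 ⟨x₁, hx₁, rfl⟩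
  exact hnot _ h1 ((key _ h1).2 fun ν' hν' _ => hnot ν' hν')

end Mitchell

/-! ## Enumerations and cardinality -/

section Cardinality

variable {M : Set ZFSet.{u}} [hM : Fact (IsTransitiveModelZFC M)]

/-- Some set maps `a` onto a superset of `b`. -/
def Onto (a b : M) : Prop := ∃ f, ∀ y, y ∊ b → ∃ x, x ∊ a ∧ ap f x = y

theorem Onto.mono {a b b' : M} (h : Onto a b) (hb : IsSubset b' b) : Onto a b' :=
  let ⟨f, hf⟩ := h
  ⟨f, fun y hy => hf y (hb y hy)⟩

theorem onto_of_forall {a b : M} (G : M → M) [hG : DefT Set.univ (fun v : ℕ → M => G (v 0))]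
    (h : ∀ y, y ∊ b → ∃ x, x ∊ a ∧ G x = y) : Onto a b :=
  ⟨lam a G, fun y hy => let ⟨x, hx, hxy⟩ := h y hy; ⟨x, hx, (ap_lam hx).trans hxy⟩⟩

theorem Onto.trans {a b c : M} (h : Onto a b) (h' : Onto b c) : Onto a c := by
  obtain ⟨f, hf⟩ := h
  obtain ⟨g, hg⟩ := h'
  refine onto_of_forall (fun x => ap g (ap f x)) fun z hz => ?_
  obtain ⟨y, hy, rfl⟩ := hg z hz
  obtain ⟨x, hx, rfl⟩ := hf y hy
  exact ⟨x, hx, rfl⟩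

theorem onto_of_injective {a b : M} (G : M → M) [hG : DefT Set.univ (fun v : ℕ → M => G (v 0))]
    (hmem : ∀ x, x ∊ a → G x ∊ b)
    (hinj : ∀ x y, x ∊ a → y ∊ a → G x = G y → x = y) : Onto b a := by
  have := hG.inst₁
  refine onto_of_forall (fun y => the fun x => x ∊ a ∧ G x = y) fun x hx => ⟨G x, hmem x hx, ?_⟩
  exact the_eq ⟨hx, rfl⟩ fun z hz => hinj z x hz.1 hx hz.2

theorem IsBij.app_iff {f a b x y : M} (hf : IsBij f a b) : App f x y ↔ x ∊ a ∧ y = ap f x :=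
  hf.1.1.app_iff'

theorem IsBij.onto {f a b : M} (hf : IsBij f a b) : Onto a b := by
  refine ⟨f, fun y hy => ?_⟩
  obtain ⟨x, hx, -⟩ := hf.2 y hy
  exact ⟨x, (hf.app_iff.1 hx).1, (hf.app_iff.1 hx).2.symm⟩

theorem isBij_lam {a b : M} (G : M → M) [hG : DefT Set.univ (fun v : ℕ → M => G (v 0))]
    (hmem : ∀ x, x ∊ a → G x ∊ b) (hinj : ∀ x y, x ∊ a → y ∊ a → G x = G y → x = y)
    (hsurj : ∀ y, y ∊ b → ∃ x, x ∊ a ∧ G x = y) : IsBij (lam a G) a b := by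
  refine ⟨⟨isFunOn_lam, fun x y hxy => ?_⟩, fun y hy => ?_⟩
  · obtain ⟨hx, rfl⟩ := app_lam.1 hxy
    exact hmem x hx
  · obtain ⟨x, hx, rfl⟩ := hsurj y hy
    refine ⟨x, app_lam.2 ⟨hx, rfl⟩, fun z hz => ?_⟩
    obtain ⟨hz, hxz⟩ := app_lam.1 hz
    exact hinj z x hz hx hxz.symm

/-- The members of `x` which are not values of `h` on `ξ`. -/
noncomputable def rem (x h ξ : M) : M := cls fun z => z ∊ x ∧ ¬ ∃ ζ, ζ ∊ ξ ∧ ap h ζ = z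

theorem mem_rem {x h ξ z : M} : z ∊ rem x h ξ ↔ z ∊ x ∧ ¬ ∃ ζ, ζ ∊ ξ ∧ ap h ζ = z := mem_sep z

/-- Enumerate `x` along the ordinal `L`, choosing the next member by `e`. Either this exhausts `x`
before `L`, or it goes on to `L`. -/
theorem exists_enum (x : M) {L : M} (hL : IsOrd L) (e : M → M)
    [hde : DefT Set.univ (fun v : ℕ → M => e (v 0))]
    (he : ∀ s, IsSubset s x → (∃ z, z ∊ s) → e s ∊ s) :
    (∃ η, η ∊ L ∧ ∃ f, IsBij f η x) ∨
      ∃ h, ∀ ξ, ξ ∊ L → ap h ξ = e (rem x h ξ) ∧ ap h ξ ∊ rem x h ξ := by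
  have := hde.inst₁
  obtain ⟨h, hh, hrec⟩ := exists_rec L (fun x y => x ∊ y)
    (fun ξ g => e (cls fun z => z ∊ x ∧ ¬ ∃ ζ, ζ ∊ ξ ∧ ap g ζ = z)) (wfOn_mem L)
  have hrec' : ∀ ξ, ξ ∊ L → ap h ξ = e (rem x h ξ) := by
    intro ξ hξ
    rw [hrec ξ hξ]
    congr 1
    refine ext fun z => ?_
    rw [mem_sep, mem_rem]
    refine and_congr_right fun _ => not_congr (exists_congr fun ζ => and_congr_right fun hζ => ?_)
    rw [hh.ap_restr (fun y hy => (mem_pred_mem.1 hy).1) (mem_pred_mem.2 ⟨hL.mem_trans hξ hζ, hζ⟩)]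
  by_cases hfull : ∃ ξ, ξ ∊ L ∧ ¬ ∃ z, z ∊ rem x h ξ
  · left
    obtain ⟨ξ, hξ⟩ := hfull
    -- At the first stage with nothing left, the values so far form a bijection onto `x`.
    obtain ⟨η, ⟨hη, hempty⟩, hmin⟩ := exists_minimal (fun ξ => ξ ∊ L ∧ ¬ ∃ z, z ∊ rem x h ξ) hξ
    have hval : ∀ ζ, ζ ∊ η → ap h ζ ∊ rem x h ζ := by
      intro ζ hζ
      have hζL := hL.mem_trans hη hζ
      rw [hrec' ζ hζL]
      refine he _ (fun z hz => (mem_rem.1 hz).1) ?_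
      by_contra hc
      exact hmin ζ hζ ⟨hζL, hc⟩
    refine ⟨η, hη, _, isBij_lam (fun ζ => ap h ζ) (fun ζ hζ => (mem_rem.1 (hval ζ hζ)).1) ?_ ?_⟩
    · intro ζ ζ' hζ hζ' heq
      rcases ((hL.mem hη).mem hζ).trichotomy ((hL.mem hη).mem hζ') with h1 | h1 | h1
      · exact ((mem_rem.1 (hval ζ' hζ')).2 ⟨ζ, h1, heq⟩).elim
      · exact h1
      · exact ((mem_rem.1 (hval ζ hζ)).2 ⟨ζ', h1, heq.symm⟩).elim
    · intro y hy
      by_contra hc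
      exact hempty ⟨y, mem_rem.2 ⟨hy, hc⟩⟩
  · right
    push Not at hfull
    refine ⟨h, fun ξ hξ => ⟨hrec' ξ hξ, ?_⟩⟩
    rw [hrec' ξ hξ]
    exact he _ (fun z hz => (mem_rem.1 hz).1) (hfull ξ hξ)

theorem enum_injective {x L h : M} (hL : IsOrd L) (hh : ∀ ξ, ξ ∊ L → ap h ξ ∊ rem x h ξ) {ξ ζ : M}
    (hξ : ξ ∊ L) (hζ : ζ ∊ L) (heq : ap h ξ = ap h ζ) : ξ = ζ := by
  rcases (hL.mem hξ).trichotomy (hL.mem hζ) with h1 | h1 | h1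
  · exact ((mem_rem.1 (hh ζ hζ)).2 ⟨ξ, h1, heq⟩).elim
  · exact h1
  · exact ((mem_rem.1 (hh ξ hξ)).2 ⟨ζ, h1, heq.symm⟩).elim

/-- Enumerate `a` by always taking the remaining element of least index under `f`. The index used at
stage ξ is at least ξ, so the enumeration cannot go through stage θ, where the index would be at
least θ. -/
theorem exists_isBij_of_onto {θ a : M} (hθ : IsOrd θ) (h : Onto θ a) :
    ∃ η, η ∊ suc θ ∧ ∃ f, IsBij f η a := by
  obtain ⟨f, hf⟩ := h
  let P : M → M → Prop := fun s ζ => ζ ∊ θ ∧ ap f ζ ∊ s ∧ ∀ ζ', ζ' ∊ ζ → ¬ ap f ζ' ∊ s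
  let m : M → M := fun s => the (P s)
  have instm : ∀ (s : (ℕ → M) → M) [DefT Set.univ s], DefT Set.univ (fun v => m (s v)) :=
    fun s hs => DefT.subst₁ (by simp only [m, P]; infer_instance) hs
  have hm : ∀ s, IsSubset s a → (∃ z, z ∊ s) → P s (m s) := by
    rintro s hs ⟨z, hz⟩
    obtain ⟨x, hx, rfl⟩ := hf z (hs z hz)
    obtain ⟨ζ, ⟨hζ, hζs⟩, hmin⟩ := exists_minimal (fun ζ => ζ ∊ θ ∧ ap f ζ ∊ s) ⟨hx, hz⟩
    have hPζ : P s ζ := ⟨hζ, hζs, fun ζ' hζ' hc => hmin ζ' hζ' ⟨hθ.mem_trans hζ hζ', hc⟩⟩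
    refine the_spec (P := P s) ⟨ζ, hPζ, fun ζ' hζ' => ?_⟩
    rcases (hθ.mem hζ'.1).trichotomy (hθ.mem hζ) with h1 | h1 | h1
    · exact (hPζ.2.2 ζ' h1 hζ'.2.1).elim
    · exact h1
    · exact (hζ'.2.2 ζ h1 hζs).elim
  rcases exists_enum a hθ.suc (fun s => ap f (m s)) (fun s hs hne => (hm s hs hne).2.1) with h | h
  · exact h
  · exfalso
    obtain ⟨h, hh⟩ := h
    have hsub : ∀ ξ, IsSubset (rem a h ξ) a := fun ξ z hz => (mem_rem.1 hz).1
    have hPm : ∀ ξ, ξ ∊ suc θ → P (rem a h ξ) (m (rem a h ξ)) := fun ξ hξ =>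
      hm _ (hsub ξ) ⟨_, (hh ξ hξ).2⟩
    -- At a least violation ξ let ζ < ξ be the index used. The element of index ζ was still
    -- available at stage ζ, so stage ζ used index at most ζ; by minimality it used exactly ζ, and
    -- that element was gone before stage ξ.
    have key : ∀ ξ, ξ ∊ suc θ → ¬ m (rem a h ξ) ∊ ξ := by
      intro ξ hξ hc
      obtain ⟨ξ, ⟨hξ, hc⟩, hmin⟩ :=
        exists_minimal (fun ξ => ξ ∊ suc θ ∧ m (rem a h ξ) ∊ ξ) ⟨hξ, hc⟩
      have hζ := hθ.suc.mem_trans hξ hc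
      have h1 := hPm ξ hξ
      have h2 := hPm _ hζ
      have h3 : ¬ m (rem a h (m (rem a h ξ))) ∊ m (rem a h ξ) := fun h => hmin _ hc ⟨hζ, h⟩
      have h4 : ¬ m (rem a h ξ) ∊ m (rem a h (m (rem a h ξ))) := fun h4 =>
        h2.2.2 _ h4 (mem_rem.2 ⟨hsub _ _ h1.2.1, fun ⟨ζ, hζ', he⟩ => (mem_rem.1 h1.2.1).2
          ⟨ζ, (hθ.suc.mem hξ).mem_trans hc hζ', he⟩⟩)
      have h5 : m (rem a h (m (rem a h ξ))) = m (rem a h ξ) := by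
        rcases (hθ.mem h2.1).trichotomy (hθ.mem h1.1) with h | h | h
        · exact (h3 h).elim
        · exact h
        · exact (h4 h).elim
      refine (mem_rem.1 h1.2.1).2 ⟨_, hc, ?_⟩
      rw [(hh _ hζ).1, h5]
    have hθs : θ ∊ suc θ := (mem_suc _ _).2 (Or.inr rfl)
    exact key θ hθs (hPm θ hθs).1

theorem isSuccTwoPow_of_onto {κ l : M} (hl : IsOrd l) (h1 : ∀ η, η ∊ l → Onto (pow κ) η)
    (h2 : ¬ Onto (pow κ) l) : IsSuccTwoPow l κ := by
  obtain ⟨e, he⟩ := exists_choice (pow κ)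
  -- An enumeration of P(κ) running through all of `l` would be injective, and its inverse would map
  -- P(κ) onto `l`.
  have hθ₀ : ∃ η, η ∊ l ∧ ∃ f, IsBij f η (pow κ) := by
    rcases exists_enum (pow κ) hl (fun s => ap e s) he with h | ⟨h, hh⟩
    · exact h
    · exact (h2 (onto_of_injective (fun ξ => ap h ξ) (fun ξ hξ => (mem_rem.1 (hh ξ hξ).2).1)
        fun ξ ζ hξ hζ => enum_injective hl (fun ξ hξ => (hh ξ hξ).2) hξ hζ)).elim
  obtain ⟨θ₀, hθ₀, hbij⟩ := hθ₀
  obtain ⟨θ, ⟨hθ, hθbij⟩, hmin⟩ := exists_minimal (fun η => IsOrd η ∧ ∃ f, IsBij f η (pow κ))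
    ⟨hl.mem hθ₀, hbij⟩
  have hθl : θ ∊ l := by
    rcases hθ.trichotomy (hl.mem hθ₀) with h | rfl | h
    · exact hl.mem_trans hθ₀ h
    · exact hθ₀
    · exact (hmin θ₀ h ⟨hl.mem hθ₀, hbij⟩).elim
  refine ⟨pow κ, θ, mem_pow κ, ⟨hθ, hθbij, fun η hη hc => hmin η hη ⟨hθ.mem hη, hc⟩⟩,
    ⟨hl, ⟨_, isBij_lam (fun x => x) (fun _ h => h) (fun _ _ _ _ h => h) fun y hy => ⟨y, hy, rfl⟩⟩,
      ?_⟩, hθl, ?_⟩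
  · rintro η hη ⟨f, hf⟩
    exact h2 ((h1 η hη).trans hf.onto)
  · intro μ hμ hθμ
    rcases hμ.1.mem_or_subset hl with h | h
    · exfalso
      obtain ⟨f, hf⟩ := hθbij
      obtain ⟨η, hη, hbij⟩ := exists_isBij_of_onto hθ (hf.onto.trans (h1 μ h))
      refine hμ.2.2 η ?_ hbij
      rcases (mem_suc _ _).1 hη with hη | rfl
      · exact hμ.1.mem_trans hθμ hη
      · exact hθμ
    · exact h

end Cardinality

/-! ## The Mitchell rank -/

section Rank

variable {M : Set ZFSet.{u}} [hM : Fact (IsTransitiveModelZFC M)] {κ μ : M}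

/-- The Mitchell rank is defined by recursion along `Rep`, which is well-founded on the normal
measures by `wfOn_rep`. -/
theorem exists_rank (κ : M) : ∃ D r : M, (∀ μ, μ ∊ D ↔ IsNormalMeasure κ μ) ∧ IsFunOn r D ∧
    ∀ μ, μ ∊ D → ∀ ξ, ξ ∊ ap r μ ↔ ∃ ν, ν ∊ D ∧ Rep κ μ ν ∧ ξ ∊ suc (ap r ν) := by
  have hD : ∀ μ, μ ∊ cls (fun μ => IsNormalMeasure κ μ) ↔ IsNormalMeasure κ μ :=
    mem_cls (pow (pow κ)) fun μ h => (mem_pow _ _).2 fun X hX => (mem_pow _ _).2 (h.2.2.1.1 X hX)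
  obtain ⟨D, hD⟩ : ∃ D : M, ∀ μ, μ ∊ D ↔ IsNormalMeasure κ μ := ⟨_, hD⟩
  have instP : DefT Set.univ (fun v : ℕ → M => pred D (fun ν μ => Rep κ μ ν) (v 0)) := by
    unfold pred; infer_instance
  have instP' := instP.inst₁
  have hpred : ∀ μ ν, ν ∊ pred D (fun ν μ => Rep κ μ ν) μ ↔ ν ∊ D ∧ Rep κ μ ν := fun μ ν =>
    mem_sep ν
  obtain ⟨r, hr, hrec⟩ := exists_rec D (fun ν μ => Rep κ μ ν)
    (fun μ g => sUnion (image (pred D (fun ν μ => Rep κ μ ν) μ) fun ν => suc (ap g ν)))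
    (wfOn_rep fun μ h => (hD μ).1 h)
  refine ⟨D, r, hD, hr, fun μ hμ ξ => ?_⟩
  rw [hrec μ hμ, mem_sUnion]
  have hsub : IsSubset (pred D (fun ν μ => Rep κ μ ν) μ) D := fun ν hν => ((hpred _ _).1 hν).1
  constructor
  · rintro ⟨w, hw, hξ⟩
    obtain ⟨ν, hν, rfl⟩ := (mem_image w).1 hw
    rw [hr.ap_restr hsub hν] at hξ
    exact ⟨ν, ((hpred _ _).1 hν).1, ((hpred _ _).1 hν).2, hξ⟩
  · rintro ⟨ν, hν, hR, hξ⟩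
    have hν' := (hpred μ ν).2 ⟨hν, hR⟩
    exact ⟨_, (mem_image _).2 ⟨ν, hν', rfl⟩, by rwa [hr.ap_restr hsub hν']⟩

/-- The first entry of an ordered pair. -/
noncomputable def fst (p : M) : M := the fun x => ∃ y, p = op x y

/-- The second entry of an ordered pair. -/
noncomputable def snd (p : M) : M := the fun y => ∃ x, p = op x y

instance {C : Set M} {s : (ℕ → M) → M} [hs : DefT C s] : DefT C (fun v => fst (s v)) :=
  DefT.subst₁ (by unfold fst; infer_instance) hs

instance {C : Set M} {s : (ℕ → M) → M} [hs : DefT C s] : DefT C (fun v => snd (s v)) :=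
  DefT.subst₁ (by unfold snd; infer_instance) hs

theorem fst_op (x y : M) : fst (op x y) = x :=
  the_eq ⟨y, rfl⟩ fun _ ⟨_, h⟩ => (op_inj.1 h).1.symm

theorem snd_op (x y : M) : snd (op x y) = y :=
  the_eq ⟨x, rfl⟩ fun _ ⟨_, h⟩ => (op_inj.1 h).2.symm

/-- By `capture` G(ξ) is almost everywhere Y ∩ ξ; since also G(ξ) ⊆ α, it is Y ∩ α once ξ > α. -/
theorem IsNormalMeasure.eventually_eq_const (h : IsNormalMeasure κ μ) {α : M} (hα : α ∊ κ)
    (G : M → M) [hG : DefT Set.univ (fun v : ℕ → M => G (v 0))]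
    (hev : ∀ᶠ ξ in h.ae, IsSubset (G ξ) α) : ∃ c, ∀ᶠ ξ in h.ae, G ξ = c := by
  obtain ⟨Y, -, hY⟩ := h.capture G (by
    filter_upwards [hev, h.eventually_gt hα, h.2.2.1.eventually_mem] with ξ h1 h2 h3
    exact fun z hz => (h.1.mem h3).mem_trans h2 (h1 z hz))
  refine ⟨inter Y α, ?_⟩
  filter_upwards [hev, hY, h.eventually_gt hα, h.2.2.1.eventually_mem] with ξ h1 h2 h3 h4
  refine ext fun z => ⟨fun hz => (mem_inter _ _ _).2 ⟨?_, h1 z hz⟩, fun hz => ?_⟩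
  · rw [h2, mem_inter] at hz
    exact hz.1
  · rw [mem_inter] at hz
    rw [h2, mem_inter]
    exact ⟨hz.1, (h.1.mem h4).mem_trans h3 hz.2⟩

/-- A measurable `κ` enumerates the pairs `(α, z)` with `z ⊆ α ∊ κ`. -/
theorem IsNormalMeasure.exists_enum_pairs (h : IsNormalMeasure κ μ) :
    ∃ f : M, ∀ α z, α ∊ κ → IsSubset z α → ∃ ξ, ξ ∊ κ ∧ ap f ξ = op α z := by
  let W : M := cls fun p => ∃ α z, α ∊ κ ∧ IsSubset z α ∧ p = op α z
  have hW : ∀ p, p ∊ W ↔ ∃ α z, α ∊ κ ∧ IsSubset z α ∧ p = op α z := by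
    refine mem_cls (prod κ (pow κ)) ?_
    rintro _ ⟨α, z, hα, hz, rfl⟩
    exact op_mem_prod.2 ⟨hα, (mem_pow _ _).2 fun w hw => h.1.mem_trans hα (hz w hw)⟩
  obtain ⟨e, he⟩ := exists_choice W
  -- Pairs are listed by least first coordinate. If (α, z) were never reached in κ steps, all listed
  -- pairs would consist of subsets of α.
  let low : M → M := fun s => cls fun p => p ∊ s ∧ ∀ q, q ∊ s → ¬ fst q ∊ fst p
  have hlow : ∀ s p, p ∊ low s ↔ p ∊ s ∧ ∀ q, q ∊ s → ¬ fst q ∊ fst p := fun s p => mem_sep p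
  have instlow : ∀ (s : (ℕ → M) → M) [DefT Set.univ s], DefT Set.univ (fun v => low (s v)) :=
    fun s hs => DefT.subst₁ (by simp only [low]; infer_instance) hs
  have hlow' : ∀ s, IsSubset s W → (∃ z, z ∊ s) → ap e (low s) ∊ low s := by
    rintro s hs ⟨z, hz⟩
    refine he _ (fun p hp => hs p ((hlow s p).1 hp).1) ?_
    obtain ⟨β, ⟨p, hp, rfl⟩, hmin⟩ := exists_minimal (fun β => ∃ p, p ∊ s ∧ fst p = β) ⟨z, hz, rfl⟩
    exact ⟨p, (hlow s p).2 ⟨hp, fun q hq hc => hmin _ hc ⟨q, hq, rfl⟩⟩⟩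
  rcases exists_enum W h.1 (fun s => ap e (low s))
    (fun s hs hne => ((hlow s _).1 (hlow' s hs hne)).1) with ⟨η, hη, f, hf⟩ | ⟨f, hf⟩
  · refine ⟨f, fun α z hα hz => ?_⟩
    obtain ⟨ξ, hξ, -⟩ := hf.2 _ ((hW _).2 ⟨α, z, hα, hz, rfl⟩)
    rw [hf.app_iff] at hξ
    exact ⟨ξ, h.1.mem_trans hη hξ.1, hξ.2.symm⟩
  · refine ⟨f, fun α z hα hz => ?_⟩
    by_contra hc
    have hp : op α z ∊ W := (hW _).2 ⟨α, z, hα, hz, rfl⟩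
    have hval : ∀ ξ, ξ ∊ κ → ∃ β w, IsSubset β α ∧ IsSubset w β ∧ ap f ξ = op β w := by
      intro ξ hξ
      have hmem : ∀ q, q ∊ rem W f ξ → q ∊ W := fun q hq => (mem_rem.1 hq).1
      have h1 := hlow' (rem W f ξ) hmem ⟨_, (hf ξ hξ).2⟩
      rw [← (hf ξ hξ).1, hlow] at h1
      obtain ⟨β, w, hβ, hw, hβw⟩ := (hW _).1 (hmem _ h1.1)
      have h2 := h1.2 (op α z) (mem_rem.2 ⟨hp, fun ⟨ζ, hζ, hζe⟩ =>
        hc ⟨ζ, h.1.mem_trans hξ hζ, hζe⟩⟩)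
      rw [hβw, fst_op, fst_op] at h2
      exact ⟨β, w, ((h.1.mem hα).mem_or_subset (h.1.mem hβ)).resolve_left h2, hw, hβw⟩
    obtain ⟨c, hcev⟩ := h.eventually_eq_const hα (fun ξ => fst (ap f ξ)) (by
      filter_upwards [h.2.2.1.eventually_mem] with ξ hξ
      obtain ⟨β, w, hβ, -, he⟩ := hval ξ hξ
      rwa [he, fst_op])
    obtain ⟨d, hdev⟩ := h.eventually_eq_const hα (fun ξ => snd (ap f ξ)) (by
      filter_upwards [h.2.2.1.eventually_mem] with ξ hξ
      obtain ⟨β, w, hβ, hw, he⟩ := hval ξ hξ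
      rw [he, snd_op]
      exact fun z hz => hβ z (hw z hz))
    -- Both coordinates are constant on a measure one set, against the injectivity of the
    -- enumeration.
    have hev : ∀ᶠ ξ in h.ae, ξ ∊ κ ∧ ap f ξ = op c d := by
      filter_upwards [h.2.2.1.eventually_mem, hcev, hdev] with ξ h1 h2 h3
      obtain ⟨β, w, -, -, he⟩ := hval ξ h1
      rw [he, fst_op] at h2
      rw [he, snd_op] at h3
      exact ⟨h1, by rw [he, h2, h3]⟩
    have := h.2.2.1.neBot
    obtain ⟨ξ, hξ, hξe⟩ := hev.exists
    obtain ⟨ζ, ⟨hζ, hζe⟩, hξζ⟩ := (hev.and (h.eventually_gt hξ)).exists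
    exact (mem_rem.1 (hf ζ hζ).2).2 ⟨ξ, hξζ, hξe.trans hζe.symm⟩

/-- For every family of sets of subsets of `κ` indexed by the subsets of `κ` there is a normal
measure whose ultrapower contains all of its members. -/
def UltsCaptureFamilies (κ : M) : Prop :=
  ∀ F, ∃ μ, IsNormalMeasure κ μ ∧ ∀ A, IsSubset A κ → ∃ g, ∀ Y, IsSubset Y κ →
    (op A Y ∊ F ↔ Large κ μ fun α => inter Y α ∊ ap g α)

/-- A single set X is the section at ∅ of the family {∅} × X. -/
theorem UltsCaptureFamilies.ultsCaptureAll (h : UltsCaptureFamilies κ) : UltsCaptureAll κ := by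
  intro X hX
  obtain ⟨μ, hμ, hA⟩ := h (prod (upair emp emp) X)
  refine ⟨μ, hμ, (hμ.inUlt_iff hX).2 ?_⟩
  obtain ⟨g, hg⟩ := hA emp fun z hz => (not_mem_emp z hz).elim
  refine ⟨g, fun Y hY => ?_⟩
  rw [← hg Y hY, op_mem_prod, mem_upair]
  tauto

/-- The hypothesis is used only to show that P(κ) does not map onto o(κ); that P(κ) maps onto each
smaller ordinal follows by coding representing functions as subsets of κ. -/
theorem UltsCaptureFamilies.mitchellMaximal (h : UltsCaptureFamilies κ) : MitchellMaximal κ := by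
  obtain ⟨D, r, hD, hr, hrmem⟩ := exists_rank κ
  have hwf : WFOn D (fun ν μ => Rep κ μ ν) := wfOn_rep fun μ h => (hD μ).1 h
  have hord : ∀ μ, μ ∊ D → IsOrd (ap r μ) := by
    refine hwf.induction (fun μ => IsOrd (ap r μ)) fun μ hμ ih => ?_
    refine isOrd_of (fun ξ hξ ζ hζ => ?_) fun ξ hξ => ?_
    · obtain ⟨ν, hν, hR, hξ⟩ := (hrmem μ hμ ξ).1 hξ
      exact (hrmem μ hμ ζ).2 ⟨ν, hν, hR, (ih ν hν hR).suc.mem_trans hξ hζ⟩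
    · obtain ⟨ν, hν, hR, hξ⟩ := (hrmem μ hμ ξ).1 hξ
      exact (ih ν hν hR).suc.mem hξ
  -- Ranks have no gaps, because the order is transitive.
  have hval : ∀ μ, μ ∊ D → ∀ ξ, ξ ∊ ap r μ → ∃ ν, ν ∊ D ∧ Rep κ μ ν ∧ ap r ν = ξ := by
    refine hwf.induction (fun μ => ∀ ξ, ξ ∊ ap r μ → ∃ ν, ν ∊ D ∧ Rep κ μ ν ∧ ap r ν = ξ)
      fun μ hμ ih ξ hξ => ?_
    obtain ⟨ν, hν, hR, hξ⟩ := (hrmem μ hμ ξ).1 hξ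
    rcases (mem_suc _ _).1 hξ with hξ | rfl
    · obtain ⟨ν', hν', hR', he⟩ := ih ν hν hR ξ hξ
      exact ⟨ν', hν', ((hD μ).1 hμ).rep_trans hR hR', he⟩
    · exact ⟨ν, hν, hR, rfl⟩
  let l := sUnion (image D fun μ => suc (ap r μ))
  have hl : ∀ ξ, ξ ∊ l ↔ ∃ μ, μ ∊ D ∧ ξ ∊ suc (ap r μ) := by
    intro ξ
    simp only [l]
    rw [mem_sUnion]
    constructor
    · rintro ⟨w, hw, hξ⟩
      obtain ⟨μ, hμ, rfl⟩ := (mem_image w).1 hw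
      exact ⟨μ, hμ, hξ⟩
    · rintro ⟨μ, hμ, hξ⟩
      exact ⟨_, (mem_image _).2 ⟨μ, hμ, rfl⟩, hξ⟩
  have hlord : IsOrd l := by
    refine isOrd_of (fun ξ hξ ζ hζ => ?_) fun ξ hξ => ?_
    · obtain ⟨μ, hμ, hξ⟩ := (hl ξ).1 hξ
      exact (hl ζ).2 ⟨μ, hμ, (hord μ hμ).suc.mem_trans hξ hζ⟩
    · obtain ⟨μ, hμ, hξ⟩ := (hl ξ).1 hξ
      exact (hord μ hμ).suc.mem hξ
  refine ⟨l, ⟨D, r, hD, hr, ?_, ?_⟩, isSuccTwoPow_of_onto hlord ?_ ?_⟩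
  · intro μ ρ hμρ ξ
    obtain ⟨hμ, rfl⟩ := hr.app_iff'.1 hμρ
    have h1 := (hD μ).1 hμ
    rw [hrmem μ hμ]
    constructor
    · rintro ⟨ν, hν, hR, hξ⟩
      exact ⟨ν, _, hν, (h1.inUlt_iff ((hD ν).1 hν).2.2.1.1).2 hR, hr.app_iff'.2 ⟨hν, rfl⟩,
        (mem_suc _ _).1 hξ⟩
    · rintro ⟨ν, σ, hν, hU, hσ, hξ⟩
      obtain ⟨-, rfl⟩ := hr.app_iff'.1 hσ
      exact ⟨ν, hν, (h1.inUlt_iff ((hD ν).1 hν).2.2.1.1).1 hU, (mem_suc _ _).2 hξ⟩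
  · intro ξ
    rw [hl]
    constructor
    · rintro ⟨μ, hμ, hξ⟩
      exact ⟨μ, _, hr.app_iff'.2 ⟨hμ, rfl⟩, (mem_suc _ _).1 hξ⟩
    · rintro ⟨μ, ρ, hμρ, hξ⟩
      obtain ⟨hμ, rfl⟩ := hr.app_iff'.1 hμρ
      exact ⟨μ, hμ, (mem_suc _ _).2 hξ⟩
  · intro η hη
    obtain ⟨μ, hμ, hη⟩ := (hl η).1 hη
    have hsub : IsSubset η (ap r μ) := by
      rcases (mem_suc _ _).1 hη with hη | rfl
      · exact (hord μ hμ).1 η hη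
      · exact fun _ h => h
    refine Onto.mono ?_ hsub
    have h1 := (hD μ).1 hμ
    obtain ⟨f, hf⟩ := h1.exists_enum_pairs
    -- A subset Y of κ codes, through `f`, a set of pairs (α, z) with z ⊆ α, hence a function g; it
    -- is sent to the rank of the set that g represents modulo μ.
    refine onto_of_forall (fun Y => ap r (cls fun X => X ∊ pow κ ∧ Large κ μ fun α =>
      ∃ ξ, ξ ∊ Y ∧ ap f ξ = op α (inter X α))) fun ξ hξ => ?_
    obtain ⟨ν, hν, ⟨g, hg⟩, rfl⟩ := hval μ hμ ξ hξ
    rw [h1.represents_iff] at hg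
    refine ⟨cls fun ξ => ξ ∊ κ ∧ ∃ α z, ap f ξ = op α z ∧ z ∊ ap g α,
      (mem_pow _ _).2 fun z hz => ((mem_sep z).1 hz).1, ?_⟩
    congr 1
    refine ext fun X => ?_
    rw [mem_sep, mem_pow, ← h1.2.2.1.eventually_iff]
    have key : (∀ᶠ α in h1.ae, ∃ ξ, (ξ ∊ cls fun ξ => ξ ∊ κ ∧ ∃ α z, ap f ξ = op α z ∧ z ∊ ap g α) ∧
        ap f ξ = op α (inter X α)) ↔ ∀ᶠ α in h1.ae, inter X α ∊ ap g α := by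
      refine Filter.eventually_congr ?_
      filter_upwards [h1.2.2.1.eventually_mem] with α hα
      constructor
      · rintro ⟨ξ, hξ, he⟩
        obtain ⟨-, β, z, he', hz⟩ := (mem_sep ξ).1 hξ
        obtain ⟨rfl, rfl⟩ := op_inj.1 (he.symm.trans he')
        exact hz
      · intro hz
        obtain ⟨ξ, hξ, he⟩ := hf α (inter X α) hα fun w hw => ((mem_inter _ _ _).1 hw).2
        exact ⟨ξ, (mem_sep ξ).2 ⟨hξ, α, _, he, hz⟩, he⟩
    rw [key]
    exact ⟨fun hX => (hg X hX.1).2 hX.2, fun hX =>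
      have hXκ := ((hD ν).1 hν).2.2.1.1 X hX
      ⟨hXκ, (hg X hXκ).1 hX⟩⟩
  · rintro ⟨s, hs⟩
    obtain ⟨N, -, hN⟩ := exists_choice_fun (fun A ν => ap r ν = ap s A) (pow κ) D
    -- The section of `F` at A is a measure of rank s(A), whenever one exists.
    let F := cls fun p => p ∊ prod (pow κ) (pow κ) ∧ ∃ A B, p = op A B ∧ B ∊ ap N A
    have hF : ∀ p, p ∊ F ↔ p ∊ prod (pow κ) (pow κ) ∧ ∃ A B, p = op A B ∧ B ∊ ap N A :=
      fun p => mem_sep p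
    obtain ⟨μ, hμ, hμF⟩ := h F
    have hμD := (hD μ).2 hμ
    obtain ⟨A, hA, hAμ⟩ := hs (ap r μ) ((hl _).2 ⟨μ, hμD, (mem_suc _ _).2 (Or.inr rfl)⟩)
    obtain ⟨hND, hNe⟩ := hN A hA ⟨μ, hμD, hAμ.symm⟩
    obtain ⟨g, hg⟩ := hμF A ((mem_pow _ _).1 hA)
    have hR : Rep κ μ (ap N A) := by
      refine ⟨g, fun Y hY => ?_⟩
      rw [← hg Y hY, hF, op_mem_prod]
      constructor
      · exact fun hYN => ⟨⟨hA, (mem_pow _ _).2 hY⟩, A, Y, rfl, hYN⟩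
      · rintro ⟨-, A', Y', he, hYN⟩
        obtain ⟨rfl, rfl⟩ := op_inj.1 he
        exact hYN
    -- The rank of μ is s(A) for some A; the measure chosen for A has the same rank, yet lies below
    -- μ.
    have : ap r μ ∊ ap r μ := (hrmem μ hμD _).2
      ⟨ap N A, hND, hR, (mem_suc _ _).2 (Or.inr (by rw [hNe, hAμ]))⟩
    exact mem_irrefl _ this

end Rank

/-! ## The embedding -/

section Embedding

variable {M : Set ZFSet.{u}}

/-- No constants are allowed, since j may move them; parameters enter through `v`. -/
theorem Def.map {Q : (ℕ → M) → Prop} (h : Def ∅ Q) (j : setLang.ElementaryEmbedding M M)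
    (v : ℕ → M) : Q (fun n => j (v n)) ↔ Q v := by
  obtain ⟨φ, hφ⟩ := h.out
  rw [← hφ v, ← j.map_formula φ, ← hφ]
  congr! 1
  funext x
  rcases x with n | c
  · rfl
  · exact c.2.elim

theorem map_mem_iff {j : setLang.ElementaryEmbedding M M} {x y : M} : j x ∊ j y ↔ x ∊ y :=
  Def.map (Q := fun v => v 0 ∊ v 1) inferInstance j (scons x fun _ => y)

/-- Freezing all entries but the first turns a parameter-free relation into a predicate usable in
separation. -/
theorem Def.fix {Q : (ℕ → M) → Prop} (h : Def ∅ Q) (p : ℕ → M) :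
    Def Set.univ (fun v : ℕ → M => Q (scons (v 0) p)) := by
  obtain ⟨φ, hφ⟩ := h.out
  refine ⟨φ.relabel (Sum.elim (fun n => Nat.casesOn n (Sum.inl 0) fun m => Sum.inr ⟨p m, trivial⟩)
    fun c => c.2.elim), fun v => ?_⟩
  rw [Formula.realize_relabel, ← hφ]
  congr! 1
  funext x
  rcases x with (_ | n) | c
  · rfl
  · rfl
  · exact c.2.elim

theorem Def.formula (φ : setLang.Formula (Fin 1)) :
    Def ∅ (fun v : ℕ → M => φ.Realize fun _ => v 0) :=
  ⟨φ.relabel fun _ => Sum.inl 0, fun v => by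
    rw [Formula.realize_relabel]
    rfl⟩

variable [hM : Fact (IsTransitiveModelZFC M)]

theorem Large.congr {κ μ : M} {P Q : M → Prop} (h : ∀ α, α ∊ κ → (P α ↔ Q α)) :
    Large κ μ P ↔ Large κ μ Q := by
  have : (fun α => α ∊ κ ∧ P α) = fun α => α ∊ κ ∧ Q α :=
    funext fun α => propext (and_congr_right (h α))
  rw [Large, Large, this]

theorem forMeasureOneMany_iff {U κ : M} {P : M → Prop}
    [hP : Def Set.univ (fun v : ℕ → M => P (v 0))] : ForMeasureOneMany U κ P ↔ Large κ U P := by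
  have : ((cls fun α => α ∊ κ ∧ P α : M) : ZFSet.{u}) =
      ZFSet.sep (fun α => ∃ hα : α ∈ M, P ⟨α, hα⟩) (κ : ZFSet.{u}) := by
    ext z
    rw [ZFSet.mem_sep]
    constructor
    · intro hz
      have hzM := hM.out.1 _ (cls fun α => α ∊ κ ∧ P α : M).2 z hz
      have := (mem_sep (⟨z, hzM⟩ : M)).1 hz
      exact ⟨this.1, hzM, this.2⟩
    · rintro ⟨hz, hzM, hPz⟩
      exact (mem_sep (⟨z, hzM⟩ : M)).2 ⟨hz, hPz⟩
  rw [ForMeasureOneMany, ← this]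
  rfl

variable {j : setLang.ElementaryEmbedding M M} {κ U : M}

/-! ### The critical point and its derived ultrafilter. -/

namespace IsCrit

variable (hκ : IsCrit j κ)
include hκ

theorem isOrd : IsOrd κ := isOrd_iff.2 hκ.1

theorem mem_map : κ ∊ j κ := by
  have h : IsOrd (j κ) := (Def.map (Q := fun v => IsOrd (v 0)) inferInstance j fun _ => κ).2 hκ.isOrd
  rcases hκ.isOrd.trichotomy h with h1 | h1 | h1
  · exact h1
  · exact (hκ.2.1 h1.symm).elim
  · exact (hκ.2.1 (j.injective (hκ.2.2 _ h1))).elim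

theorem inter_map {A : M} (hA : IsSubset A κ) : inter (j A) κ = A := by
  refine ext fun ξ => ?_
  rw [mem_inter]
  constructor
  · rintro ⟨h1, h2⟩
    rw [← hκ.2.2 ξ h2] at h1
    exact map_mem_iff.1 h1
  · intro h
    refine ⟨?_, hA ξ h⟩
    rw [← hκ.2.2 ξ (hA ξ h)]
    exact map_mem_iff.2 h

variable (hU : ∀ X, X ∊ U ↔ IsSubset X κ ∧ κ ∊ j X)
include hU

/-- By elementarity j sends {α < κ : Q(α, p)} to {α < j(κ) : Q(α, j(p))}; whether κ belongs to the
latter is the question, and κ < j(κ). -/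
theorem large_iff {Q : (ℕ → M) → Prop} (hQ : Def ∅ Q) (p : ℕ → M) :
    Large κ U (fun α => Q (scons α p)) ↔ Q (scons κ fun n => j (p n)) := by
  have := hQ.fix p
  have hQ' : Def ∅ (fun v : ℕ → M => Q (scons (v 0) fun n => v (n + 1 + 2))) :=
    (hQ.relabel fun n => Nat.casesOn n 0 fun m => m + 1 + 2).congr fun v => by
      rw [show (fun n => v (Nat.casesOn n 0 fun m => m + 1 + 2)) =
        scons (v 0) fun n => v (n + 1 + 2) from funext fun n => by cases n <;> rfl]
  let S := cls fun α => α ∊ κ ∧ Q (scons α p)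
  have h := (Def.map (Q := fun v => ∀ α, α ∊ v 0 ↔ α ∊ v 1 ∧ Q (scons α fun n => v (n + 2)))
    inferInstance j (scons S (scons κ p))).2 fun α => mem_sep α
  have h' := h κ
  have hS : IsSubset S κ := fun z hz => ((mem_sep z).1 hz).1
  rw [Large, hU, and_iff_right hS]
  exact h'.trans (and_iff_right hκ.mem_map)

theorem isNormalMeasure : IsNormalMeasure κ U := by
  have hlim : (∃ z, z ∊ κ) ∧ ∀ z, z ∊ κ → ∃ y, y ∊ κ ∧ z ∊ y := by
    constructor
    · exact (Def.map (Q := fun v => ∃ z, z ∊ v 0) inferInstance j fun _ => κ).1 ⟨κ, hκ.mem_map⟩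
    · intro z hz
      refine (Def.map (Q := fun v => ∃ y, y ∊ v 0 ∧ v 1 ∊ y) inferInstance j
        (scons κ fun _ => z)).1 ⟨κ, hκ.mem_map, ?_⟩
      change j z ∊ κ
      rwa [hκ.2.2 z hz]
  -- As β < κ is fixed, j(f)(β) = j(f(β)), which contains κ because f(β) ∈ U.
  have hval : ∀ {f a β X}, IsFun f a U → β ∊ κ → (β ∊ j a → β ∊ a) → App (j f) β X → κ ∊ X := by
    intro f a β X hf hβκ hβa hX
    have hjf : IsFunOn (j f) (j a) :=
      (Def.map (Q := fun v => IsFunOn (v 0) (v 1)) inferInstance j (scons f fun _ => a)).2 hf.1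
    have hβ := hβa (hjf.app_iff'.1 hX).1
    obtain ⟨X₀, hX₀, -⟩ := hf.1.2 β hβ
    have h1 : App (j f) (j β) (j X₀) := (Def.map (Q := fun v => App (v 0) (v 1) (v 2))
      inferInstance j (scons f (scons β fun _ => X₀))).2 hX₀
    rw [hκ.2.2 β hβκ] at h1
    rw [(hjf.app_iff'.1 hX).2, ← (hjf.app_iff'.1 h1).2]
    exact ((hU X₀).1 (hf.2 β X₀ hX₀)).2
  refine ⟨hκ.isOrd, ?_, ⟨fun X hX => ((hU X).1 hX).1, (hU κ).2 ⟨fun _ h => h, hκ.mem_map⟩,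
    ?_, ?_, ?_⟩, ?_, ?_, ?_⟩
  -- κ is itself a nonzero limit ordinal below j(κ), so there is one below κ.
  · refine (Def.map (Q := fun v => ∃ w, w ∊ v 0 ∧ (∃ z, z ∊ w) ∧
      ∀ z, z ∊ w → ∃ y, y ∊ w ∧ z ∊ y) inferInstance j fun _ => κ).1 ⟨κ, hκ.mem_map, hlim⟩
  · intro X Y hX hXY hY
    refine (hU Y).2 ⟨hY, ?_⟩
    exact (Def.map (Q := fun v => IsSubset (v 0) (v 1)) inferInstance j
      (scons X fun _ => Y)).2 hXY κ ((hU X).1 hX).2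
  · intro X Y Z hX hY hZ
    rw [hU] at hX hY ⊢
    have h := (Def.map (Q := fun v => ∀ x, x ∊ v 0 ↔ x ∊ v 1 ∧ x ∊ v 2) inferInstance j
      (scons Z (scons X fun _ => Y))).2 hZ
    exact ⟨fun z hz => hX.1 z ((hZ z).1 hz).1, (h κ).2 ⟨hX.2, hY.2⟩⟩
  · intro X Y hX hY
    have h : κ ∊ j Y ↔ κ ∊ j κ ∧ ¬ κ ∊ j X :=
      (Def.map (Q := fun v => ∀ x, x ∊ v 0 ↔ x ∊ v 1 ∧ ¬ x ∊ v 2) inferInstance j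
        (scons Y (scons κ fun _ => X))).2 hY κ
    have hYκ : IsSubset Y κ := fun z hz => ((hY z).1 hz).1
    rw [hU, hU, and_iff_right hX, and_iff_right hYκ, h, and_iff_right hκ.mem_map, not_not]
  · intro α s hα hs hsU
    have h : κ ∊ j s ↔ κ = j α ∨ κ = j α :=
      (Def.map (Q := fun v => IsUPair (v 0) (v 1) (v 1)) inferInstance j
        (scons s fun _ => α)).2 hs κ
    have h1 := h.1 ((hU s).1 hsU).2
    rw [or_self, hκ.2.2 α hα] at h1
    exact mem_irrefl α (h1 ▸ hα)
  · intro γ f Y hγ hf hY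
    have h : κ ∊ j Y ↔ κ ∊ j κ ∧ ∀ β X, App (j f) β X → κ ∊ X :=
      (Def.map (Q := fun v => ∀ x, x ∊ v 0 ↔ x ∊ v 1 ∧ ∀ β X, App (v 2) β X → x ∊ X)
        inferInstance j (scons Y (scons κ fun _ => f))).2 hY κ
    refine (hU Y).2 ⟨fun z hz => ((hY z).1 hz).1, h.2 ⟨hκ.mem_map, fun β X hX => ?_⟩⟩
    have hjf : IsFunOn (j f) (j γ) :=
      (Def.map (Q := fun v => IsFunOn (v 0) (v 1)) inferInstance j (scons f fun _ => γ)).2 hf.1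
    have hβ := (hjf.app_iff'.1 hX).1
    rw [hκ.2.2 γ hγ] at hβ
    exact hval hf (hκ.isOrd.mem_trans hγ hβ) (fun _ => hβ) hX
  · intro f Y hf hY
    have h : κ ∊ j Y ↔ κ ∊ j κ ∧ ∀ β X, β ∊ κ → App (j f) β X → κ ∊ X :=
      (Def.map (Q := fun v => ∀ x, x ∊ v 0 ↔ x ∊ v 1 ∧ ∀ β X, β ∊ x → App (v 2) β X → x ∊ X)
        inferInstance j (scons Y (scons κ fun _ => f))).2 hY κ
    exact (hU Y).2 ⟨fun z hz => ((hY z).1 hz).1,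
      h.2 ⟨hκ.mem_map, fun β X hβ hX => hval hf hβ (fun _ => hβ) hX⟩⟩

theorem ultsCaptureFamilies : UltsCaptureFamilies κ := by
  by_contra hcon
  let Bad : M → M → Prop := fun α F => ∀ μ, IsNormalMeasure α μ → ∃ A, IsSubset A α ∧
    ¬ ∃ g, ∀ Y, IsSubset Y α → (op A Y ∊ F ↔ Large α μ fun β => inter Y β ∊ ap g β)
  have instBad : ∀ {C : Set M} (s t : (ℕ → M) → M) [DefT C s] [DefT C t],
      Def C (fun v => Bad (s v) (t v)) :=
    fun s t hs ht => Def.subst₂ (by simp only [Bad]; infer_instance) hs ht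
  have instUlts : ∀ {C : Set M} (s : (ℕ → M) → M) [DefT C s],
      Def C (fun v => UltsCaptureFamilies (s v)) :=
    fun s hs => Def.subst₁ (by unfold UltsCaptureFamilies; infer_instance) hs
  have hbad : ∀ α, α ∊ κ → ¬ UltsCaptureFamilies α →
      ∃ F, F ∊ pow (prod (pow κ) (pow κ)) ∧ Bad α F := by
    intro α hα hc
    simp only [UltsCaptureFamilies, not_forall] at hc
    obtain ⟨F, hF⟩ := hc
    -- Only pairs of subsets of α matter; trimming puts the counterexamples for all α < κ in one
    -- set, as choice requires.
    refine ⟨inter F (prod (pow α) (pow α)), ?_, fun μ hμ => ?_⟩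
    · rw [mem_pow]
      intro p hp
      obtain ⟨A, B, hA, hB, rfl⟩ := (mem_prod _ _ _).1 ((mem_inter _ _ _).1 hp).2
      rw [mem_pow] at hA hB
      exact op_mem_prod.2 ⟨(mem_pow _ _).2 fun z hz => hκ.isOrd.mem_trans hα (hA z hz),
        (mem_pow _ _).2 fun z hz => hκ.isOrd.mem_trans hα (hB z hz)⟩
    · by_contra hall
      refine hF ⟨μ, hμ, fun A hA => ?_⟩
      by_contra hg
      refine hall ⟨A, hA, fun ⟨g, hg'⟩ => hg ⟨g, fun Y hY => ?_⟩⟩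
      rw [← hg' Y hY, mem_inter, op_mem_prod, mem_pow, mem_pow]
      exact (and_iff_left ⟨hA, hY⟩).symm
  obtain ⟨f, -, hf⟩ := exists_choice_fun (fun α F : M => Bad α F) κ (pow (prod (pow κ) (pow κ)))
  -- Badness quantifies over all normal measures of M, so j(f)(κ) must in particular defeat U.
  have hjf := (Def.map (Q := fun v => ∀ α, α ∊ v 0 → ¬ UltsCaptureFamilies α →
    Bad α (ap (v 1) α)) inferInstance j (scons κ fun _ => f)).2
    (fun α hα hc => (hf α hα (hbad α hα hc)).2) κ hκ.mem_map hcon U (hκ.isNormalMeasure hU)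
  obtain ⟨A, hA, hg⟩ := hjf
  -- The section of f(α) at A ∩ α represents the section of j(f)(κ) at A.
  refine hg ⟨lam κ fun α => cls fun Y => Y ∊ pow α ∧ op (inter A α) Y ∊ ap f α, fun Y hY => ?_⟩
  have h := hκ.large_iff hU (Q := fun v => op (inter (v 1) (v 0)) (inter (v 2) (v 0)) ∊ ap (v 3) (v 0))
    inferInstance (scons A (scons Y fun _ => f))
  change Large κ U (fun α => op (inter A α) (inter Y α) ∊ ap f α) ↔
    op (inter (j A) κ) (inter (j Y) κ) ∊ ap (j f) κ at h
  rw [hκ.inter_map hA, hκ.inter_map hY] at h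
  refine h.symm.trans (Large.congr fun α hα => ?_)
  rw [ap_lam hα, mem_sep, mem_pow]
  exact (and_iff_right fun z hz => ((mem_inter _ _ _).1 hz).2).symm

end IsCrit

end Embedding
end SetModel

/-! ### The main theorem. -/

open SetModel in
theorem mainTheorem5 (M : Set ZFSet.{u}) (hM : SetModel.IsTransitiveModelZFC M)
    (j : SetModel.setLang.ElementaryEmbedding M M)
    (κ : M) (hκ : SetModel.IsCrit j κ)
    (U : M) (hU : {X | X ∈ (U : ZFSet.{u})} = SetModel.derivedUltrafilter j κ) :
    SetModel.MitchellMaximal κ ∧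
    SetModel.UltsCaptureAll κ ∧
    SetModel.ForMeasureOneMany U κ
      (fun α => SetModel.MitchellMaximal α ∧ SetModel.UltsCaptureAll α) ∧
    ∀ (φ : SetModel.setLang.Formula (Fin 1)) (A : M), (A : ZFSet.{u}) ⊆ (κ : ZFSet.{u}) →
      (φ.Realize (fun _ => A) ↔
        SetModel.ForMeasureOneMany U κ (fun α =>
          ∃ B : M, (B : ZFSet.{u}) = (A : ZFSet.{u}) ∩ (α : ZFSet.{u}) ∧
            φ.Realize (fun _ => B))) := by
  have : Fact (IsTransitiveModelZFC M) := ⟨hM⟩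
  have hU' : ∀ X, X ∊ U ↔ IsSubset X κ ∧ κ ∊ j X := by
    intro X
    have h : (X : ZFSet.{u}) ∈ (U : ZFSet.{u}) ↔ _ := Set.ext_iff.1 hU X
    rw [mem_def, h, isSubset_iff]
    exact ⟨fun ⟨_, h⟩ => h, fun h => ⟨X.2, h⟩⟩
  have hcap := hκ.ultsCaptureFamilies hU'
  refine ⟨hcap.mitchellMaximal, hcap.ultsCaptureAll, ?_, fun φ A hA => ?_⟩
  · rw [forMeasureOneMany_iff]
    exact (hκ.large_iff hU' (Q := fun v => MitchellMaximal (v 0) ∧ UltsCaptureAll (v 0))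
      inferInstance fun _ => κ).2 ⟨hcap.mitchellMaximal, hcap.ultsCaptureAll⟩
  -- Claim 4 is `large_iff` for the relation φ(A ∩ α): at α = κ the parameter becomes j(A), and j(A)
  -- ∩ κ = A.
  · have hφ : Def ∅ (fun v : ℕ → M => φ.Realize fun _ => inter (v 1) (v 0)) :=
      Def.subst₁ (P := fun x => φ.Realize fun _ => x) (Def.formula φ) inferInstance
    have hfix := hφ.fix fun _ => A
    have heq : (fun α : M => ∃ B : M, (B : ZFSet.{u}) = (A : ZFSet.{u}) ∩ (α : ZFSet.{u}) ∧
        φ.Realize (fun _ => B)) = fun α => φ.Realize fun _ => inter A α := by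
      funext α
      have hval : (inter A α : ZFSet.{u}) = (A : ZFSet.{u}) ∩ (α : ZFSet.{u}) := by
        ext z
        rw [ZFSet.mem_inter]
        constructor
        · intro hz
          exact (mem_inter A α ⟨z, hM.1 _ (inter A α).2 z hz⟩).1 hz
        · intro hz
          exact (mem_inter A α ⟨z, hM.1 _ A.2 z hz.1⟩).2 hz
      refine propext ⟨?_, fun h => ⟨_, hval, h⟩⟩
      rintro ⟨B, hB, h⟩
      rwa [← show B = inter A α from Subtype.ext (hB.trans hval.symm)]
    have h := hκ.large_iff hU' hφ fun _ => A
    change Large κ U (fun α => φ.Realize fun _ => inter A α) ↔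
      φ.Realize (fun _ => inter (j A) κ) at h
    rw [hκ.inter_map (isSubset_iff.2 hA)] at h
    rw [heq]
    exact h.symm.trans (@forMeasureOneMany_iff M _ U κ _ hfix).symm
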